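/- Let $d\ge 1$ be an integer and let $\mu\ge 0$. Put $\nu=\tfrac12\sqrt{1-4\mu}$ if $\mu\le\tfrac14$ and $\nu=\tfrac i2\sqrt{4\mu-1}$ if $\mu>\tfrac14$. Let $\dot H^1(\mathbb R^d)$ be the complete space of tempered distributions $f$ with $\nabla f\in L^2(\mathbb R^d)$, modulo constants, with norm $\|f\|_{\dot H^1}=\|\nabla f\|_{L^2}$, and give $\dot H^1\times L^2$ the norm $\|(f,g)\|_{\dot H^1\times L^2}=(\|f\|_{\dot H^1}^2+\|g\|_{L^2}^2)^{1/2}$. Let $$\mathcal W(t)(f,g)=\bigl(\cos(t|\nabla|)f+|\nabla|^{-1}\sin(t|\nabla|)g,\ -|\nabla|\sin(t|\nabla|)f+\cos(t|\nabla|)g\bigr)$$ be the solution map of the free wave equation $\partial_t^2w-\Delta w=0$. There is a constant $C>0$, depending only on $d$ and $\mu$, such that the following holds. Let $(v_0,v_1)\in H^1(\mathbb R^d)\times L^2(\mathbb R^d)$ (complex valued), and let $v\in C([0,\infty);H^1(\mathbb R^d))\cap C^1([0,\infty);L^2(\mathbb R^d))$ be the solution, in the sense of distributions, of $$\partial_t^2v-\Delta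 v+\frac{\mu}{(1+t)^2}v=0\quad\text{on }(0,\infty)\times\mathbb R^d,\qquad (v(0),\partial_tv(0))=(v_0,v_1).$$ Write $\vec v(t)=(v(t),\partial_tv(t))$. Then there exists $\vec v_+\in\dot H^1(\mathbb R^d)\times L^2(\mathbb R^d)$ such that for all $t\ge 0$ $$\|\vec v(t)-\mathcal W(t)\vec v_+\|_{\dot H^1\times L^2}\le C\,\mu\,\bigl(\|v_0\|_{L^2}+\|v_1\|_{L^2}\bigr)\begin{cases}(1+t)^{-\frac12+\mathrm{Re}\,\nu},&\mu\ne\tfrac14,\\(1+t)^{-\frac12}\bigl(1+\log(1+t)\bigr),&\mu=\tfrac14.\end{cases}$$ -/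

import Mathlib

open MeasureTheory Set
open scoped SchwartzMap LineDeriv Laplacian ENNReal

namespace KleinGordon

noncomputable section

/-- The Euclidean space `ℝ^d`. -/
abbrev Space (d : ℕ) := EuclideanSpace ℝ (Fin d)

/-- The complex Lebesgue space `L²(ℝ^d)`; its elements are coerced to tempered distributions. -/
abbrev L2 (d : ℕ) := Lp ℂ 2 (volume : Measure (Space d))

/-- The `i`-th vector of the standard basis of `ℝ^d`. -/
def e {d : ℕ} (i : Fin d) : Space d := EuclideanSpace.single i (1 : ℝ)

/-- The `L²` norm of a tempered distribution: the norm of the `L²` function that represents it,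
and `∞` if there is none. -/
def l2Norm {d : ℕ} (f : 𝓢'(Space d, ℂ)) : ℝ≥0∞ :=
  ⨅ (g : L2 d) (_ : f = (g : 𝓢'(Space d, ℂ))), ‖g‖ₑ

/-- The homogeneous Sobolev norm `‖f‖_{Ḣ¹} = ‖∇f‖_{L²}` of a tempered distribution, `∞` if the
distributional gradient is not in `L²`. -/
def homNorm {d : ℕ} (f : 𝓢'(Space d, ℂ)) : ℝ≥0∞ :=
  (∑ i : Fin d, l2Norm (∂_{(e i : Space d)} f) ^ 2) ^ (1 / 2 : ℝ)

/-- The norm of `Ḣ¹ × L²`. -/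
def energyNorm {d : ℕ} (p : 𝓢'(Space d, ℂ) × 𝓢'(Space d, ℂ)) : ℝ≥0∞ :=
  (homNorm p.1 ^ 2 + l2Norm p.2 ^ 2) ^ (1 / 2 : ℝ)

/-- The energy space `Ḣ¹(ℝ^d) × L²(ℝ^d)`. Here `Ḣ¹(ℝ^d)` is the complete space of all tempered
distributions with gradient in `L²`, modulo constants; we work with representatives, on which
`homNorm` is a seminorm that vanishes exactly on the constants. -/
def MemEnergySpace {d : ℕ} (p : 𝓢'(Space d, ℂ) × 𝓢'(Space d, ℂ)) : Prop :=
  homNorm p.1 < ∞ ∧ l2Norm p.2 < ∞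

/-- The operator `cos (t|∇|)`. In the normalization of the Fourier transform used by Mathlib,
`|∇|` is the multiplication by `2π‖ξ‖`. The symbol, and the two symbols below, are smooth functions
of `‖ξ‖²` of temperate growth, so they act on all tempered distributions. -/
def W0 {d : ℕ} (t : ℝ) : 𝓢'(Space d, ℂ) →L[ℂ] 𝓢'(Space d, ℂ) :=
  TemperedDistribution.fourierMultiplierCLM ℂ
    fun ξ : Space d ↦ ((Real.cos (t * (2 * Real.pi * ‖ξ‖)) : ℝ) : ℂ)

/-- The operator `|∇|⁻¹ sin (t|∇|)`; its symbol is `sin (tρ) / ρ` with `ρ = 2π‖ξ‖`, and `t` at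
`ρ = 0`. -/
def W1 {d : ℕ} (t : ℝ) : 𝓢'(Space d, ℂ) →L[ℂ] 𝓢'(Space d, ℂ) :=
  TemperedDistribution.fourierMultiplierCLM ℂ
    fun ξ : Space d ↦ ((t * Real.sinc (t * (2 * Real.pi * ‖ξ‖)) : ℝ) : ℂ)

/-- The operator `-|∇| sin (t|∇|)`, the time derivative of `cos (t|∇|)`. -/
def W0dot {d : ℕ} (t : ℝ) : 𝓢'(Space d, ℂ) →L[ℂ] 𝓢'(Space d, ℂ) :=
  TemperedDistribution.fourierMultiplierCLM ℂ
    fun ξ : Space d ↦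
      ((-(2 * Real.pi * ‖ξ‖) * Real.sin (t * (2 * Real.pi * ‖ξ‖)) : ℝ) : ℂ)

/-- The solution map `𝓦(t)` of the free wave equation, on pairs (position, velocity). The time
derivative of `|∇|⁻¹ sin (t|∇|)` is `cos (t|∇|)`. It commutes with adding a constant to the
position, hence descends to classes modulo constants. -/
def freeWave {d : ℕ} (t : ℝ) (p : 𝓢'(Space d, ℂ) × 𝓢'(Space d, ℂ)) :
    𝓢'(Space d, ℂ) × 𝓢'(Space d, ℂ) :=
  (W0 t p.1 + W1 t p.2, W0dot t p.1 + W0 t p.2)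

/-- `v` is a finite energy solution on `[0, ∞)`, with time derivative `w`, of
`∂ₜ²v - Δv + μ (1 + t)⁻² v = 0` with `(v, ∂ₜv) = (v₀, v₁)` at `t = 0`, that is,
`v ∈ C([0, ∞); H¹) ∩ C¹([0, ∞); L²)`, and the equation holds in the sense of distributions. -/
structure IsSolution {d : ℕ} (μ : ℝ) (v₀ v₁ : L2 d) (v w : ℝ → L2 d) : Prop where
  hasDeriv : ∀ t ∈ Ici (0 : ℝ), HasDerivWithinAt v (w t) (Ici 0) t
  continuousOn_deriv : ContinuousOn w (Ici 0)
  continuousOn_grad : ∀ i : Fin d, ∃ G : ℝ → L2 d, ContinuousOn G (Ici 0) ∧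
    ∀ t ∈ Ici (0 : ℝ), ∂_{(e i : Space d)} (v t : 𝓢'(Space d, ℂ)) = (G t : 𝓢'(Space d, ℂ))
  equation : ∀ φ : 𝓢(Space d, ℂ), ∀ t ∈ Ioi (0 : ℝ),
    HasDerivAt (fun s ↦ (w s : 𝓢'(Space d, ℂ)) φ)
      ((v t : 𝓢'(Space d, ℂ)) (Δ φ)
        - ((μ / (1 + t) ^ 2 : ℝ) : ℂ) * (v t : 𝓢'(Space d, ℂ)) φ) t
  initial_value : v 0 = v₀
  initial_velocity : w 0 = v₁

/-- `ν = ½√(1 - 4μ)` if `μ ≤ 1/4` and `ν = (i/2)√(4μ - 1)` if `μ > 1/4`. -/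
def nu (μ : ℝ) : ℂ :=
  if μ ≤ 1 / 4 then 1 / 2 * (Real.sqrt (1 - 4 * μ) : ℂ)
  else Complex.I / 2 * (Real.sqrt (4 * μ - 1) : ℂ)

/-- The decay rate. -/
def rate (μ t : ℝ) : ℝ :=
  if μ = 1 / 4 then (1 + t) ^ (-(1 / 2) : ℝ) * (1 + Real.log (1 + t))
  else (1 + t) ^ (-(1 / 2) + (nu μ).re)

end

end KleinGordon

/-!
On the Fourier side the equation becomes, at the frequency `ρ = 2π‖ξ‖`, the oscillator
`y'' + (ρ² + μ (1 + t)⁻²) y = 0`.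

*Growth.* In the variable `τ = log (1 + t)` the oscillator has a zero order coefficient
`μ + ρ² e^{2τ}` that increases with `τ`. The energy, corrected by a multiple of `⟨y, y'⟩` chosen
according to the indicial roots `1/2 ± ν`, divided by a constant plus `ρ² (1 + t)²` (with a factor
accounting for the growth of `y`), is then nonincreasing. This gives
`|y (t)| ≤ C (1 + t)^{1/2 + Re ν} (|y (0)| + |y' (0)|)` with `C` independent of `ρ`, with an
additional logarithm for `μ = 1/4`
(`ShellMoments.growth_of_lt`, `ShellMoments.growth_of_gt`, `ShellMoments.growth_of_eq`).
A solution with values in `L²` cannot be evaluated at a frequency, so the argument is applied to its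
parts in the dyadic shells `2^j ≤ ρ < 2^{j+1}`, on which `ρ` is known up to the factor `2`; the
functionals involve only `‖y‖²`, `Re ⟨y, y'⟩`, `‖y'‖²` and `‖ρ y‖²`. Summation over the shells gives
the growth of `‖v (t)‖` (`exists_norm_le_growth`).

*Scattering.* The profiles `e^{∓itρ} (∂ₜv ± iρ v)` have the derivative `-μ (1 + t)⁻² e^{∓itρ} v`, so
by the growth bound they converge in `L²`, at the rate of the integral of
`μ (1 + s)⁻² (1 + s)^{1/2 + Re ν}` over `s ≥ t`, which is the claimed rate
(`FourierSolution.norm_profile_sub_le`, `exists_primitive_growth`). The limits determine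
`g` and `k`, the Fourier transforms of `|∇| f` and of `h`, where `(f, h)` is the asymptotic state.

*The asymptotic state.* Its position `f` is obtained by regularizing `g / ρ` at the origin
(`riesz`). The symbols of the gradient and of `-|∇| sin (t|∇|)` vanish at the origin, so the choice
of the regularization is not visible to the energy norm, which is therefore controlled by the
distance of the profiles to their limits.
-/

namespace KleinGordon

/-! ### Temperate growth of the symbols of the wave group -/

open scoped ContDiff in
/-- A sequence of bounded functions in which the gradient of each member is a multiple of the next
member times `x`. All derivatives of the members are then polynomially bounded. -/
theorem hasTemperateGrowth_of_radial_chain {H : Type*} [NormedAddCommGroup H]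
    [InnerProductSpace ℝ H] {f : ℕ → H → ℝ} {a B : ℕ → ℝ}
    (hf : ∀ n x, HasFDerivAt (f n) ((a n * f (n + 1) x) • innerSL ℝ x) x)
    (hB : ∀ n x, |f n x| ≤ B n) (n : ℕ) : (f n).HasTemperateGrowth := by
  have hdiff : ∀ n, Differentiable ℝ (f n) := fun n x ↦ (hf n x).differentiableAt
  have hfd : ∀ n, fderiv ℝ (f n) = fun x ↦ f (n + 1) x • (a n • innerSL ℝ (E := H)) x := by
    intro n
    ext1 x
    rw [(hf n x).fderiv]
    simp [smul_smul, mul_comm]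
  have hlin : ∀ n, (fun x : H ↦ (a n • innerSL ℝ (E := H)) x).HasTemperateGrowth := fun n ↦
    ContinuousLinearMap.hasTemperateGrowth _
  have hsmooth : ∀ N : ℕ, ∀ n, ContDiff ℝ N (f n) := by
    intro N
    induction N with
    | zero => exact fun n ↦ contDiff_zero.2 (hdiff n).continuous
    | succ N ih =>
      intro n
      rw [show ((N + 1 : ℕ) : ℕ∞ω) = (N : ℕ∞ω) + 1 by simp]
      refine contDiff_succ_iff_fderiv.2 ⟨hdiff n, by simp, ?_⟩
      rw [hfd n]
      exact (ih (n + 1)).smul ((hlin n).1.of_le (mod_cast le_top))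
  have hbound : ∀ N : ℕ, ∀ j ≤ N, ∀ n, ∃ (k : ℕ) (C : ℝ), ∀ x,
      ‖iteratedFDeriv ℝ j (f n) x‖ ≤ C * (1 + ‖x‖) ^ k := by
    intro N
    induction N with
    | zero =>
      intro j hj n
      obtain rfl : j = 0 := by omega
      exact ⟨0, B n, fun x ↦ by simpa using hB n x⟩
    | succ N ih =>
      intro j hj n
      rcases j with _ | j
      · exact ih 0 (Nat.zero_le _) n
      choose k C h using fun i : Fin (j + 1) ↦ ih i (by omega) (n + 1)
      choose k' C' h' using (hlin n).2
      refine ⟨∑ i : Fin (j + 1), (k i + k' (j - i)),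
        ∑ i : Fin (j + 1), (j.choose i : ℝ) * |C i| * |C' (j - i)|, fun x ↦ ?_⟩
      rw [← norm_iteratedFDeriv_fderiv, hfd n]
      refine (norm_iteratedFDeriv_smul_le (hsmooth j (n + 1)) ((hlin n).1.of_le (mod_cast le_top)) x
        le_rfl).trans ?_
      rw [Finset.sum_range, Finset.sum_mul]
      refine Finset.sum_le_sum fun i _ ↦ ?_
      calc (j.choose i : ℝ) * ‖iteratedFDeriv ℝ i (f (n + 1)) x‖ * ‖iteratedFDeriv ℝ (j - i)
              (fun x ↦ (a n • innerSL ℝ (E := H)) x) x‖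
          ≤ (j.choose i : ℝ) * (|C i| * (1 + ‖x‖) ^ k i)
              * (|C' (j - i)| * (1 + ‖x‖) ^ k' (j - i)) := by
            gcongr
            · exact (h i x).trans (by gcongr; exact le_abs_self _)
            · exact (h' _ x).trans (by gcongr; exact le_abs_self _)
        _ = (j.choose i : ℝ) * |C i| * |C' (j - i)| * (1 + ‖x‖) ^ (k i + k' (j - i)) := by
            rw [pow_add]; ring
        _ ≤ _ := by
            gcongr
            · simp
            · exact (Finset.single_le_sum (f := fun i : Fin (j + 1) ↦ k i + k' (j - i))
                (fun _ _ ↦ Nat.zero_le _) (Finset.mem_univ i))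
  refine ⟨contDiff_infty.2 fun N ↦ hsmooth N n, fun N ↦ hbound N N le_rfl n⟩

noncomputable section

/-- The function `M_n(r) = ∫₀¹ (1 - s²)ⁿ cos (r s) ds`, a multiple of `r^(-n-1/2) J_{n+1/2}(r)`;
in particular `M_0` is the cardinal sine. -/
def poissonIntegral (n : ℕ) (r : ℝ) : ℝ := ∫ s in (0 : ℝ)..1, (1 - s ^ 2) ^ n * Real.cos (r * s)

end

theorem poissonIntegral_zero (r : ℝ) : poissonIntegral 0 r = Real.sinc r := by
  rcases eq_or_ne r 0 with rfl | hr
  · simp [poissonIntegral]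
  · simp only [poissonIntegral, pow_zero, one_mul]
    rw [intervalIntegral.integral_comp_mul_left (fun x ↦ Real.cos x) hr, Real.sinc_of_ne_zero hr]
    simp [div_eq_inv_mul]

theorem abs_poissonIntegral_le (n : ℕ) (r : ℝ) : |poissonIntegral n r| ≤ 1 := by
  have := intervalIntegral.norm_integral_le_of_norm_le_const (a := (0 : ℝ)) (b := 1) (C := 1)
    (f := fun s ↦ (1 - s ^ 2) ^ n * Real.cos (r * s)) fun s hs ↦ by
      rw [uIoc_of_le zero_le_one] at hs
      rw [norm_mul, norm_pow]
      refine mul_le_one₀ (pow_le_one₀ (norm_nonneg _) ?_) (norm_nonneg _) (Real.abs_cos_le_one _)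
      rw [Real.norm_eq_abs, abs_le]
      constructor <;> nlinarith [hs.1, hs.2]
  simpa [poissonIntegral] using this

/-- Differentiation under the integral followed by an integration by parts. -/
theorem hasDerivAt_poissonIntegral (n : ℕ) (r : ℝ) :
    HasDerivAt (poissonIntegral n) (-(r / (2 * n + 2)) * poissonIntegral (n + 1) r) r := by
  have h1 : HasDerivAt (poissonIntegral n)
      (∫ s in (0 : ℝ)..1, (1 - s ^ 2) ^ n * (-Real.sin (r * s) * s)) r := by
    refine (intervalIntegral.hasDerivAt_integral_of_dominated_loc_of_deriv_le
      (F := fun r s ↦ (1 - s ^ 2) ^ n * Real.cos (r * s))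
      (F' := fun r s ↦ (1 - s ^ 2) ^ n * (-Real.sin (r * s) * s)) (bound := fun _ ↦ 1)
      Filter.univ_mem ?_ ?_ ?_ ?_ ?_ ?_).2
    · exact Filter.Eventually.of_forall fun r ↦ Continuous.aestronglyMeasurable (by fun_prop)
    · exact Continuous.intervalIntegrable (by fun_prop) _ _
    · exact Continuous.aestronglyMeasurable (by fun_prop)
    · refine Filter.Eventually.of_forall fun s hs r _ ↦ ?_
      rw [uIoc_of_le zero_le_one] at hs
      rw [norm_mul, norm_pow, norm_mul, norm_neg]
      refine mul_le_one₀ (pow_le_one₀ (norm_nonneg _) ?_) (by positivity)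
        (mul_le_one₀ (Real.abs_sin_le_one _) (norm_nonneg _) ?_)
      · rw [Real.norm_eq_abs, abs_le]
        constructor <;> nlinarith [hs.1, hs.2]
      · rw [Real.norm_eq_abs, abs_le]
        constructor <;> linarith [hs.1, hs.2]
    · exact intervalIntegrable_const
    · refine Filter.Eventually.of_forall fun s hs r _ ↦ ?_
      have := ((hasDerivAt_id r).mul_const s).cos.const_mul ((1 - s ^ 2) ^ n)
      simpa using! this
  convert h1 using 1
  have hn : (2 * n + 2 : ℝ) ≠ 0 := by positivity
  have h2 : ∀ s ∈ uIcc (0 : ℝ) 1, HasDerivAt (fun s ↦ (1 - s ^ 2) ^ (n + 1) * Real.sin (r * s))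
      ((1 - s ^ 2) ^ (n + 1) * (r * Real.cos (r * s))
        + (2 * n + 2) * ((1 - s ^ 2) ^ n * (-Real.sin (r * s) * s))) s := by
    intro s _
    have hp := ((hasDerivAt_pow 2 s).const_sub 1).fun_pow (n + 1)
    have hs := ((hasDerivAt_id s).const_mul r).sin
    refine (hp.fun_mul hs).congr_deriv ?_
    simp only [id_eq, mul_one, Nat.add_sub_cancel]
    push_cast
    ring
  have h3 := intervalIntegral.integral_eq_sub_of_hasDerivAt h2
    (Continuous.intervalIntegrable (by fun_prop) _ _)
  rw [intervalIntegral.integral_add (Continuous.intervalIntegrable (by fun_prop) _ _)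
    (Continuous.intervalIntegrable (by fun_prop) _ _), intervalIntegral.integral_const_mul] at h3
  have h4 : ∫ s in (0 : ℝ)..1, (1 - s ^ 2) ^ (n + 1) * (r * Real.cos (r * s))
      = r * poissonIntegral (n + 1) r := by
    rw [poissonIntegral, ← intervalIntegral.integral_const_mul]
    congr 1; ext s; ring
  rw [h4] at h3
  have h5 : r * poissonIntegral (n + 1) r
      + (2 * n + 2) * ∫ s in (0 : ℝ)..1, (1 - s ^ 2) ^ n * (-Real.sin (r * s) * s) = 0 := by
    rw [h3]
    simp
  rw [neg_mul, div_mul_eq_mul_div, ← neg_div, div_eq_iff hn]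
  linarith

/-- The chain rule for a function of `c‖x‖` whose derivative is divisible by its argument; at the
origin, where the norm is not differentiable, the function is stationary. -/
theorem hasFDerivAt_comp_norm {H : Type*} [NormedAddCommGroup H] [InnerProductSpace ℝ H]
    {g h : ℝ → ℝ} (hg : ∀ r, HasDerivAt g (r * h r) r) (c : ℝ) (x : H) :
    HasFDerivAt (fun x : H ↦ g (c * ‖x‖)) ((c ^ 2 * h (c * ‖x‖)) • innerSL ℝ x) x := by
  rcases eq_or_ne x 0 with rfl | hx
  · have h0 : HasDerivAt (fun r ↦ g (c * r)) 0 0 := by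
      have := (hg (c * 0)).comp (0 : ℝ) ((hasDerivAt_id (0 : ℝ)).const_mul c)
      simpa using! this
    rw [hasDerivAt_iff_isLittleO] at h0
    simp only [map_zero, smul_zero, norm_zero, mul_zero, sub_zero] at h0 ⊢
    rw [hasFDerivAt_iff_isLittleO]
    have hl : Filter.Tendsto (fun x : H ↦ ‖x‖) (nhds 0) (nhds 0) := by
      simpa using (continuous_norm (E := H)).tendsto 0
    have := (h0.comp_tendsto hl)
    exact (Asymptotics.isLittleO_norm_right.1 (by simpa [Function.comp_def] using this))
  · have h1 : HasFDerivAt (fun x : H ↦ ‖x‖) ((‖x‖⁻¹) • innerSL ℝ x) x := by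
      have hsq : HasFDerivAt (fun x : H ↦ ‖x‖ ^ 2) (2 • innerSL ℝ x) x :=
        (hasStrictFDerivAt_norm_sq x).hasFDerivAt
      have hne : ‖x‖ ^ 2 ≠ 0 := by positivity
      have := hsq.sqrt hne
      simp only [Real.sqrt_sq (norm_nonneg _)] at this
      convert this using 1
      ext y
      simp
      ring
    have h2 := (hg (c * ‖x‖)).comp_hasFDerivAt x (h1.const_mul c)
    refine h2.congr_fderiv ?_
    have : ‖x‖ ≠ 0 := norm_ne_zero_iff.2 hx
    ext y
    simp
    field_simp

/-- The functions `M_n (c‖x‖)` form a chain of radial functions starting with `sinc (c‖x‖)`. -/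
theorem hasTemperateGrowth_sinc_norm {H : Type*} [NormedAddCommGroup H] [InnerProductSpace ℝ H]
    (c : ℝ) : (fun x : H ↦ Real.sinc (c * ‖x‖)).HasTemperateGrowth := by
  have := hasTemperateGrowth_of_radial_chain (H := H) (f := fun n x ↦ poissonIntegral n (c * ‖x‖))
    (a := fun n ↦ -(c ^ 2 / (2 * n + 2))) (B := fun _ ↦ 1) (fun n x ↦ by
      refine (hasFDerivAt_comp_norm (H := H) (g := poissonIntegral n)
        (h := fun r ↦ -(1 / (2 * n + 2)) * poissonIntegral (n + 1) r) (fun r ↦ by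
          refine (hasDerivAt_poissonIntegral n r).congr_deriv ?_; ring) c x).congr_fderiv ?_
      congr 1
      ring) (fun n x ↦ abs_poissonIntegral_le n _) 0
  simpa only [poissonIntegral_zero] using this

theorem hasTemperateGrowth_cos_norm {H : Type*} [NormedAddCommGroup H] [InnerProductSpace ℝ H]
    (c : ℝ) : (fun x : H ↦ Real.cos (c * ‖x‖)).HasTemperateGrowth := by
  have hd : ∀ x : H, HasFDerivAt (fun x : H ↦ Real.cos (c * ‖x‖))
      ((c ^ 2 * -Real.sinc (c * ‖x‖)) • innerSL ℝ x) x := fun x ↦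
    hasFDerivAt_comp_norm (h := fun r ↦ -Real.sinc r) (fun r ↦ by
      refine (Real.hasDerivAt_cos r).congr_deriv ?_
      rcases eq_or_ne r 0 with rfl | hr
      · simp
      · rw [Real.sinc_of_ne_zero hr]; field_simp) c x
  refine Function.HasTemperateGrowth.of_fderiv ?_ (fun x ↦ (hd x).differentiableAt) (k := 0) (C := 1)
    fun x ↦ by simpa using Real.abs_cos_le_one _
  rw [show fderiv ℝ (fun x : H ↦ Real.cos (c * ‖x‖)) = _ from funext fun x ↦ (hd x).fderiv]
  exact ((Function.HasTemperateGrowth.const (c ^ 2)).mul (hasTemperateGrowth_sinc_norm c).neg).smul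
    (innerSL ℝ (E := H)).hasTemperateGrowth

theorem hasTemperateGrowth_symbol_cos {d : ℕ} (t : ℝ) :
    (fun ξ : Space d ↦ ((Real.cos (t * (2 * Real.pi * ‖ξ‖)) : ℝ) : ℂ)).HasTemperateGrowth := by
  have := hasTemperateGrowth_cos_norm (H := Space d) (t * (2 * Real.pi))
  simp only [mul_assoc] at this ⊢
  exact Function.Complex.hasTemperateGrowth_ofReal.comp this

theorem hasTemperateGrowth_symbol_sinc {d : ℕ} (t : ℝ) :
    (fun ξ : Space d ↦ ((t * Real.sinc (t * (2 * Real.pi * ‖ξ‖)) : ℝ) : ℂ)).HasTemperateGrowth := by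
  have := (Function.HasTemperateGrowth.const t).mul
    (hasTemperateGrowth_sinc_norm (H := Space d) (t * (2 * Real.pi)))
  simp only [mul_assoc] at this ⊢
  exact Function.Complex.hasTemperateGrowth_ofReal.comp this

theorem mul_sinc (t : ℝ) (r : ℝ) : r * (t * Real.sinc (t * r)) = Real.sin (t * r) := by
  rcases eq_or_ne (t * r) 0 with h | h
  · rcases mul_eq_zero.1 h with rfl | rfl <;> simp
  · rw [Real.sinc_of_ne_zero h]; field_simp [left_ne_zero_of_mul h, right_ne_zero_of_mul h]

theorem hasTemperateGrowth_symbol_mul_sin {d : ℕ} (t : ℝ) :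
    (fun ξ : Space d ↦ ((-(2 * Real.pi * ‖ξ‖) * Real.sin (t * (2 * Real.pi * ‖ξ‖)) : ℝ) : ℂ)
      ).HasTemperateGrowth := by
  have h1 : (fun ξ : Space d ↦ ((-(2 * Real.pi) ^ 2 * ‖ξ‖ ^ 2 : ℝ) : ℂ)).HasTemperateGrowth :=
    Function.Complex.hasTemperateGrowth_ofReal.comp
      ((Function.HasTemperateGrowth.const _).mul (Function.hasTemperateGrowth_norm_sq _))
  have h2 := h1.mul (hasTemperateGrowth_symbol_sinc t)
  refine (congrArg Function.HasTemperateGrowth (funext fun ξ ↦ ?_)).mp h2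
  rw [Pi.mul_apply, ← Complex.ofReal_mul, ← mul_sinc]
  congr 1
  ring

/-! ### Growth of solutions of the oscillator equation on a frequency shell -/

theorem nu_re_of_le {μ : ℝ} (h : μ ≤ 1 / 4) : (nu μ).re = 1 / 2 * Real.sqrt (1 - 4 * μ) := by
  rw [nu, if_pos h]
  norm_num

theorem nu_re_of_lt {μ : ℝ} (h : 1 / 4 < μ) : (nu μ).re = 0 := by
  rw [nu, if_neg (not_le.2 h)]
  simp

theorem nu_re_lt_half {μ : ℝ} (hμ : 0 < μ) : (nu μ).re < 1 / 2 := by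
  rcases le_or_gt μ (1 / 4) with h | h
  · rw [nu_re_of_le h]
    have : Real.sqrt (1 - 4 * μ) < 1 := by
      rw [Real.sqrt_lt' one_pos]
      linarith
    linarith
  · rw [nu_re_of_lt h]
    norm_num

/-- The second moments of a solution of `y'' + A y + μ (1 + t)⁻² y = 0` in a Hilbert space, where
`A` is symmetric and lies between `m²` and `4m²`: here `a = ‖y‖²`, `b = Re ⟨y, y'⟩`,
`E = ‖y'‖² + ⟨A y, y⟩` and `e = ⟨A y, y⟩`. The field `pos` says that `‖y' + s y‖² ≥ 0`. -/
structure ShellMoments (μ m : ℝ) (a b E e : ℝ → ℝ) : Prop where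
  deriv_a : ∀ t ∈ Ici (0 : ℝ), HasDerivWithinAt a (2 * b t) (Ici 0) t
  deriv_b : ∀ t ∈ Ici (0 : ℝ),
    HasDerivWithinAt b (E t - 2 * e t - μ / (1 + t) ^ 2 * a t) (Ici 0) t
  deriv_E : ∀ t ∈ Ici (0 : ℝ), HasDerivWithinAt E (-2 * (μ / (1 + t) ^ 2) * b t) (Ici 0) t
  nonneg : ∀ t ∈ Ici (0 : ℝ), 0 ≤ a t
  lower : ∀ t ∈ Ici (0 : ℝ), m ^ 2 * a t ≤ e t
  upper : ∀ t ∈ Ici (0 : ℝ), e t ≤ 4 * m ^ 2 * a t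
  pos : ∀ t ∈ Ici (0 : ℝ), ∀ s, 0 ≤ E t - e t + 2 * s * b t + s ^ 2 * a t

/-- A quotient `N / D` with `N' D ≤ N D'` is nonincreasing. -/
theorem div_le_div_zero_of_deriv {N D N' D' : ℝ → ℝ}
    (hN : ∀ t ∈ Ici (0 : ℝ), HasDerivWithinAt N (N' t) (Ici 0) t)
    (hD : ∀ t ∈ Ici (0 : ℝ), HasDerivWithinAt D (D' t) (Ici 0) t)
    (hpos : ∀ t ∈ Ici (0 : ℝ), 0 < D t)
    (h : ∀ t ∈ Ici (0 : ℝ), N' t * D t ≤ N t * D' t) {t : ℝ} (ht : 0 ≤ t) :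
    N t / D t ≤ N 0 / D 0 := by
  have hq : ∀ t ∈ Ici (0 : ℝ), HasDerivWithinAt (fun t ↦ N t / D t)
      ((N' t * D t - N t * D' t) / D t ^ 2) (Ici 0) t := fun t ht ↦
    (hN t ht).fun_div (hD t ht) (hpos t ht).ne'
  have hanti : AntitoneOn (fun t ↦ N t / D t) (Ici 0) := by
    refine antitoneOn_of_hasDerivWithinAt_nonpos (convex_Ici 0)
      (fun t ht ↦ (hq t ht).continuousWithinAt)
      (fun t ht ↦ (hq t (interior_subset ht)).mono interior_subset) fun t ht ↦ ?_
    exact div_nonpos_of_nonpos_of_nonneg (sub_nonpos.2 (h t (interior_subset ht))) (sq_nonneg _)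
  exact hanti self_mem_Ici ht ht

theorem hasDerivWithinAt_one_add (t : ℝ) : HasDerivWithinAt (fun t : ℝ ↦ 1 + t) 1 (Ici 0) t :=
  ((hasDerivAt_id t).const_add 1).hasDerivWithinAt

theorem hasDerivWithinAt_one_add_sq (t : ℝ) :
    HasDerivWithinAt (fun t : ℝ ↦ (1 + t) ^ 2) (2 * (1 + t)) (Ici 0) t := by
  simpa using! (hasDerivWithinAt_one_add t).fun_pow 2

theorem hasDerivWithinAt_one_add_rpow (p : ℝ) {t : ℝ} (ht : 0 ≤ t) :
    HasDerivWithinAt (fun t : ℝ ↦ (1 + t) ^ p) (p * (1 + t) ^ p / (1 + t)) (Ici 0) t := by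
  have hx : 0 < 1 + t := by linarith
  refine ((hasDerivWithinAt_one_add t).rpow_const (p := p) (Or.inl hx.ne')).congr_deriv ?_
  rw [Real.rpow_sub_one hx.ne']
  ring

theorem hasDerivWithinAt_log_one_add {t : ℝ} (ht : 0 ≤ t) :
    HasDerivWithinAt (fun t : ℝ ↦ 1 + Real.log (1 + t)) (1 / (1 + t)) (Ici 0) t :=
  ((hasDerivWithinAt_one_add t).log (by linarith)).const_add 1

/-- Below the critical mass, the Lyapunov functional in the variables `τ = log (1 + t)` and
`z = e^{-(1/2 + ν)τ} y` is `(‖z'‖² + ‖z' + 2νz‖² + 2 e^{2τ} ⟨A z, z⟩) / (ν²/4 + m² e^{2τ})`. -/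
theorem ShellMoments.growth_of_lt {μ m ν : ℝ} {a b E e : ℝ → ℝ} (h : ShellMoments μ m a b E e)
    (hν : 0 < ν) (hν' : ν ≤ 1 / 2) (hμ : μ = 1 / 4 - ν ^ 2) {t : ℝ} (ht : 0 ≤ t) :
    a t ≤ (8 + 12 / ν ^ 2) * (1 + t) ^ (1 + 2 * ν) * (a 0 + (E 0 - e 0)) := by
  set N : ℝ → ℝ := fun t ↦ 2 * ((1 + t) ^ 2 * E t) - 2 * ((1 + t) * b t) + (1 / 2 + 2 * ν ^ 2) * a t
    with hNdef
  set D : ℝ → ℝ := fun t ↦ (1 + t) ^ (1 + 2 * ν) * (ν ^ 2 / 4 + m ^ 2 * (1 + t) ^ 2) with hDdef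
  have hDpos : ∀ t ∈ Ici (0 : ℝ), 0 < D t := fun t ht ↦ by
    have : 0 < 1 + t := by linarith [mem_Ici.1 ht]
    positivity
  have hlow : ∀ t ∈ Ici (0 : ℝ),
      2 * ν ^ 2 * a t + 2 * (1 + t) ^ 2 * e t ≤ N t := fun t ht ↦ by
    have hx : 0 < 1 + t := by linarith [mem_Ici.1 ht]
    have h1 := mul_nonneg (sq_nonneg (1 + t)) (h.pos t ht (-(1 / 2) / (1 + t)))
    -- Completing the square: `N` exceeds the lower bound by `2 ‖(1 + t) y' - y / 2‖²`.
    have h2 : (1 + t) ^ 2 * (E t - e t + 2 * (-(1 / 2) / (1 + t)) * b t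
        + (-(1 / 2) / (1 + t)) ^ 2 * a t)
        = (1 + t) ^ 2 * (E t - e t) - (1 + t) * b t + 1 / 4 * a t := by
      field_simp
      ring
    simp only [hNdef]
    nlinarith
  have key := div_le_div_zero_of_deriv (N := N) (D := D)
    (fun t ht ↦ ((((hasDerivWithinAt_one_add_sq t).fun_mul (h.deriv_E t ht)).const_mul 2).fun_sub
      (((hasDerivWithinAt_one_add t).fun_mul (h.deriv_b t ht)).const_mul 2)).fun_add
        ((h.deriv_a t ht).const_mul (1 / 2 + 2 * ν ^ 2)))
    (fun t ht ↦ (hasDerivWithinAt_one_add_rpow (1 + 2 * ν) ht).fun_mul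
      (((hasDerivWithinAt_one_add_sq t).const_mul (m ^ 2)).const_add (ν ^ 2 / 4)))
    hDpos (fun t ht ↦ ?_) ht
  · have h0 := h.pos 0 self_mem_Ici 1
    have hlow0 := hlow t ht
    have hx : 0 < 1 + t := by linarith
    have hN0 : N 0 ≤ (8 + 12 / ν ^ 2) * (a 0 + (E 0 - e 0)) * D 0 := by
      have hpos0 := h.pos 0 self_mem_Ici 0
      have ha0 := h.nonneg 0 self_mem_Ici
      have hup := h.upper 0 self_mem_Ici
      simp only [hNdef, hDdef]
      have h3 : (8 + 12 / ν ^ 2) * (a 0 + (E 0 - e 0)) * ((1 + 0) ^ (1 + 2 * ν)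
          * (ν ^ 2 / 4 + m ^ 2 * (1 + 0) ^ 2)) = (a 0 + (E 0 - e 0)) *
          (2 * ν ^ 2 + 8 * m ^ 2 + 3 + 12 * m ^ 2 / ν ^ 2) := by
        rw [add_zero, Real.one_rpow]
        field_simp
        ring
      rw [h3]
      have h4 : 0 ≤ 12 * m ^ 2 / ν ^ 2 := by positivity
      have h5 : 0 ≤ a 0 + (E 0 - e 0) := by linarith
      have h6 : 0 ≤ (E 0 - e 0) := by linarith
      have h7 := mul_nonneg h5 h4
      have h8 : 0 ≤ (E 0 - e 0) * m ^ 2 := by positivity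
      have h9 : 0 ≤ (E 0 - e 0) * ν ^ 2 := by positivity
      nlinarith
    have h1 : N t ≤ (8 + 12 / ν ^ 2) * (a 0 + (E 0 - e 0)) * D t := by
      rw [← div_le_iff₀ (hDpos t ht)]
      exact key.trans ((div_le_iff₀ (hDpos 0 self_mem_Ici)).2 hN0)
    have h2 : a t * (ν ^ 2 / 4 + m ^ 2 * (1 + t) ^ 2) ≤ N t := by
      have h3 := mul_le_mul_of_nonneg_left (h.lower t ht) (sq_nonneg (1 + t))
      have h4 := mul_nonneg (sq_nonneg ν) (h.nonneg t ht)
      have h5 : 0 ≤ (1 + t) ^ 2 * (m ^ 2 * a t) := by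
        have := h.nonneg t ht
        positivity
      nlinarith
    have hq : 0 < ν ^ 2 / 4 + m ^ 2 * (1 + t) ^ 2 := by positivity
    refine le_of_mul_le_mul_right ((h2.trans h1).trans_eq ?_) hq
    simp only [hDdef]
    ring
  · have hx : 0 < 1 + t := by linarith [mem_Ici.1 ht]
    have hP := mul_nonneg (sq_nonneg (1 + t)) (h.pos t ht (-(1 / 2 + ν) / (1 + t)))
    -- `P` is `‖z'‖²` times a power of `1 + t`; it enters with the good sign.
    set P := (1 + t) ^ 2 * (E t - e t + 2 * (-(1 / 2 + ν) / (1 + t)) * b t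
        + (-(1 / 2 + ν) / (1 + t)) ^ 2 * a t) with hPdef
    have hPeq : P = (1 + t) ^ 2 * (E t - e t) - (1 + 2 * ν) * ((1 + t) * b t)
        + (1 / 2 + ν) ^ 2 * a t := by
      rw [hPdef]
      field_simp
      ring
    have hup := h.upper t ht
    have hlo := h.lower t ht
    have ha := h.nonneg t ht
    have he : 0 ≤ e t := le_trans (by positivity) hlo
    set N' := 2 * (2 * (1 + t) * E t + (1 + t) ^ 2 * (-2 * (μ / (1 + t) ^ 2) * b t)) -
            2 * (1 * b t + (1 + t) * (E t - 2 * e t - μ / (1 + t) ^ 2 * a t)) +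
          (1 / 2 + 2 * ν ^ 2) * (2 * b t) with hN'
    have hN'eq : (1 + t) * N' = (1 + 2 * ν) * N t - 4 * ν * P
        + (4 - 4 * ν) * ((1 + t) ^ 2 * e t) := by
      rw [hN', hPeq, hμ]
      simp only [hNdef]
      field_simp
      ring
    set q := m ^ 2 * (1 + t) ^ 2 with hq
    have hq0 : 0 ≤ q := by positivity
    -- The only growing term, `e`, is absorbed by `N D'`: the constant `ν² / 4` in `D` is small
    -- enough for the part of `e` at low frequencies, where `e ≤ 4 q a`.
    have hmain : (ν ^ 2 / 4 + q) * (-4 * ν * P + (4 - 4 * ν) * ((1 + t) ^ 2 * e t))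
        ≤ 2 * q * N t := by
      have h1 : 2 * q * (2 * ν ^ 2 * a t + 2 * (1 + t) ^ 2 * e t) ≤ 2 * q * N t :=
        mul_le_mul_of_nonneg_left (hlow t ht) (by positivity)
      have h2 : (1 + t) ^ 2 * e t ≤ 4 * q * a t :=
        (mul_le_mul_of_nonneg_left hup (sq_nonneg (1 + t))).trans_eq (by rw [hq]; ring)
      have h3 : 0 ≤ (1 + t) ^ 2 * e t := by positivity
      have h4 : 0 ≤ (ν ^ 2 / 4 + q) * (4 * ν * P) := by positivity
      have h5 : ν ^ 2 * ((1 + t) ^ 2 * e t) ≤ ν ^ 2 * (4 * q * a t) :=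
        mul_le_mul_of_nonneg_left h2 (sq_nonneg ν)
      have h6 : 0 ≤ ν * ν ^ 2 * ((1 + t) ^ 2 * e t) := by positivity
      have h7 : 0 ≤ ν * q * ((1 + t) ^ 2 * e t) := by positivity
      linarith
    have hxp : 0 < (1 + t) ^ (1 + 2 * ν) := by positivity
    have hgoal : (1 + t) * N' * (ν ^ 2 / 4 + q) ≤ N t * ((1 + 2 * ν) * (ν ^ 2 / 4 + q) + 2 * q) := by
      rw [hN'eq]
      linarith
    have hfin := mul_le_mul_of_nonneg_left hgoal (div_nonneg hxp.le hx.le)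
    refine le_trans (le_of_eq ?_) (hfin.trans (le_of_eq ?_))
    · simp only [hDdef]
      rw [hq]
      field_simp
    · rw [hq]
      field_simp

/-- Above the critical mass, the Lyapunov functional in the variables `τ = log (1 + t)` and
`u = e^{-τ/2} y` is `(‖u'‖² + κ‖u‖² + e^{2τ} ⟨A u, u⟩) / (κ/4 + m² e^{2τ})`, `κ = μ - 1/4`. -/
theorem ShellMoments.growth_of_gt {μ m : ℝ} {a b E e : ℝ → ℝ} (h : ShellMoments μ m a b E e)
    (hμ : 1 / 4 < μ) {t : ℝ} (ht : 0 ≤ t) :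
    a t ≤ (4 + 4 * (2 + μ) / (μ - 1 / 4)) * (1 + t) * (a 0 + (E 0 - e 0)) := by
  obtain ⟨κ, rfl⟩ : ∃ κ, μ = κ + 1 / 4 := ⟨μ - 1 / 4, by ring⟩
  have hκ : 0 < κ := by linarith
  simp only [add_sub_cancel_right]
  set N : ℝ → ℝ := fun t ↦ (1 + t) ^ 2 * E t - (1 + t) * b t + (κ + 1 / 4) * a t with hNdef
  set D : ℝ → ℝ := fun t ↦ (1 + t) * (κ / 4 + m ^ 2 * (1 + t) ^ 2) with hDdef
  have hDpos : ∀ t ∈ Ici (0 : ℝ), 0 < D t := fun t ht ↦ by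
    have : 0 < 1 + t := by linarith [mem_Ici.1 ht]
    positivity
  have hlow : ∀ t ∈ Ici (0 : ℝ), κ * a t + (1 + t) ^ 2 * e t ≤ N t := fun t ht ↦ by
    have hx : 0 < 1 + t := by linarith [mem_Ici.1 ht]
    have h1 := mul_nonneg (sq_nonneg (1 + t)) (h.pos t ht (-(1 / 2) / (1 + t)))
    -- Completing the square: `N` exceeds the lower bound by `‖(1 + t) y' - y / 2‖²`.
    have h2 : (1 + t) ^ 2 * (E t - e t + 2 * (-(1 / 2) / (1 + t)) * b t
        + (-(1 / 2) / (1 + t)) ^ 2 * a t)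
        = (1 + t) ^ 2 * (E t - e t) - (1 + t) * b t + 1 / 4 * a t := by
      field_simp
      ring
    simp only [hNdef]
    nlinarith
  have key := div_le_div_zero_of_deriv (N := N) (D := D)
    (fun t ht ↦ (((hasDerivWithinAt_one_add_sq t).fun_mul (h.deriv_E t ht)).fun_sub
      ((hasDerivWithinAt_one_add t).fun_mul (h.deriv_b t ht))).fun_add
        ((h.deriv_a t ht).const_mul (κ + 1 / 4)))
    (fun t ht ↦ (hasDerivWithinAt_one_add t).fun_mul
      (((hasDerivWithinAt_one_add_sq t).const_mul (m ^ 2)).const_add (κ / 4)))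
    hDpos (fun t ht ↦ ?_) ht
  · have hlow0 := hlow t ht
    have hx : 0 < 1 + t := by linarith
    have hN0 : N 0 ≤ (4 + 4 * (2 + (κ + 1 / 4)) / κ) * (a 0 + (E 0 - e 0)) * D 0 := by
      have h0 := h.pos 0 self_mem_Ici 1
      have hpos0 := h.pos 0 self_mem_Ici 0
      have ha0 := h.nonneg 0 self_mem_Ici
      have hup := h.upper 0 self_mem_Ici
      simp only [hNdef, hDdef]
      have h3 : (4 + 4 * (2 + (κ + 1 / 4)) / κ) * (a 0 + (E 0 - e 0)) * ((1 + 0)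
          * (κ / 4 + m ^ 2 * (1 + 0) ^ 2)) = (a 0 + (E 0 - e 0)) *
          (κ + 4 * m ^ 2 + (2 + (κ + 1 / 4)) + 4 * (2 + (κ + 1 / 4)) * m ^ 2 / κ) := by
        field_simp
        ring
      rw [h3]
      have h4 : 0 ≤ 4 * (2 + (κ + 1 / 4)) * m ^ 2 / κ := by positivity
      have h5 : 0 ≤ a 0 + (E 0 - e 0) := by linarith
      have h6 : 0 ≤ (E 0 - e 0) := by linarith
      have h7 := mul_nonneg h5 h4
      have h8 : 0 ≤ (E 0 - e 0) * m ^ 2 := by positivity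
      have h9 : 0 ≤ (E 0 - e 0) * κ := by positivity
      have h10 : 0 ≤ a 0 * κ := by positivity
      nlinarith
    have h1 : N t ≤ (4 + 4 * (2 + (κ + 1 / 4)) / κ) * (a 0 + (E 0 - e 0)) * D t := by
      rw [← div_le_iff₀ (hDpos t ht)]
      exact key.trans ((div_le_iff₀ (hDpos 0 self_mem_Ici)).2 hN0)
    have h2 : a t * (κ / 4 + m ^ 2 * (1 + t) ^ 2) ≤ N t := by
      have h3 := mul_le_mul_of_nonneg_left (h.lower t ht) (sq_nonneg (1 + t))
      have h4 := mul_nonneg hκ.le (h.nonneg t ht)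
      nlinarith
    have hq : 0 < κ / 4 + m ^ 2 * (1 + t) ^ 2 := by positivity
    refine le_of_mul_le_mul_right ((h2.trans h1).trans_eq ?_) hq
    simp only [hDdef]
    ring
  · have hx : 0 < 1 + t := by linarith [mem_Ici.1 ht]
    have hup := h.upper t ht
    have hlo := h.lower t ht
    have ha := h.nonneg t ht
    have he : 0 ≤ e t := le_trans (by positivity) hlo
    set N' := 2 * (1 + t) * E t + (1 + t) ^ 2 * (-2 * ((κ + 1 / 4) / (1 + t) ^ 2) * b t) -
            (1 * b t + (1 + t) * (E t - 2 * e t - (κ + 1 / 4) / (1 + t) ^ 2 * a t)) +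
          (κ + 1 / 4) * (2 * b t) with hN'
    have hN'eq : (1 + t) * N' = N t + 2 * ((1 + t) ^ 2 * e t) := by
      rw [hN']
      simp only [hNdef]
      field_simp
      ring
    set q := m ^ 2 * (1 + t) ^ 2 with hq
    have hq0 : 0 ≤ q := by positivity
    -- At low frequencies `e ≤ 4 q a` is absorbed by the term `κ a` in `N`.
    have hmain : (κ / 4 + q) * (2 * ((1 + t) ^ 2 * e t)) ≤ 2 * q * N t := by
      have h1 : 2 * q * (κ * a t + (1 + t) ^ 2 * e t) ≤ 2 * q * N t :=
        mul_le_mul_of_nonneg_left (hlow t ht) (by positivity)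
      have h2 : (1 + t) ^ 2 * e t ≤ 4 * q * a t :=
        (mul_le_mul_of_nonneg_left hup (sq_nonneg (1 + t))).trans_eq (by rw [hq]; ring)
      have h5 := mul_le_mul_of_nonneg_left h2 hκ.le
      nlinarith
    have hgoal : (1 + t) * N' * (κ / 4 + q) ≤ N t * ((κ / 4 + q) + 2 * q) := by
      rw [hN'eq]
      nlinarith
    refine le_trans (le_of_eq ?_) (hgoal.trans (le_of_eq ?_))
    · simp only [hDdef]
      ring
    · rw [hq]
      ring

/-- At the critical mass, the Lyapunov functional in the variables `θ = 1 + log (1 + t)` and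
`u = (1 + t)^{-1/2} y`, with derivatives in `θ`, is
`(‖u'‖² + ‖u' - u/θ‖² + 2 (1 + t)² ⟨A u, u⟩) / (1/16 + m² (1 + t)² θ²)`. -/
theorem ShellMoments.growth_of_eq {m : ℝ} {a b E e : ℝ → ℝ} (h : ShellMoments (1 / 4) m a b E e)
    {t : ℝ} (ht : 0 ≤ t) :
    a t ≤ 160 * ((1 + t) * (1 + Real.log (1 + t)) ^ 2) * (a 0 + (E 0 - e 0)) := by
  set θ : ℝ → ℝ := fun t ↦ 1 + Real.log (1 + t) with hθdef
  have hθpos : ∀ t ∈ Ici (0 : ℝ), 0 < θ t := fun t ht ↦ by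
    have := Real.log_nonneg (x := 1 + t) (by linarith [mem_Ici.1 ht])
    simp only [hθdef]
    linarith
  set N : ℝ → ℝ := fun t ↦ 2 * ((1 + t) ^ 2 * E t) - (2 + 2 * (θ t)⁻¹) * ((1 + t) * b t)
    + (1 / 4 + (1 / 2 + (θ t)⁻¹) ^ 2) * a t with hNdef
  set D : ℝ → ℝ := fun t ↦ (1 + t) * (1 / 16 + m ^ 2 * ((1 + t) ^ 2 * θ t ^ 2)) with hDdef
  have hDpos : ∀ t ∈ Ici (0 : ℝ), 0 < D t := fun t ht ↦ by
    have : 0 < 1 + t := by linarith [mem_Ici.1 ht]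
    positivity
  have hlow : ∀ t ∈ Ici (0 : ℝ), 1 / (2 * θ t ^ 2) * a t + 2 * ((1 + t) ^ 2 * e t) ≤ N t :=
    fun t ht ↦ by
    have hx : 0 < 1 + t := by linarith [mem_Ici.1 ht]
    have hθ := hθpos t ht
    -- With `u'` the derivative in `θ`, `‖u'‖² + ‖u' - u/θ‖²` is
    -- `2 ‖u' - u/(2θ)‖² + ‖u‖²/(2θ²)`.
    have h1 := mul_nonneg (sq_nonneg (1 + t))
      (h.pos t ht (-(1 / 2 + 1 / (2 * θ t)) / (1 + t)))
    have h2 : N t = 2 * ((1 + t) ^ 2 * (E t - e t + 2 * (-(1 / 2 + 1 / (2 * θ t)) / (1 + t)) * b t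
        + (-(1 / 2 + 1 / (2 * θ t)) / (1 + t)) ^ 2 * a t))
        + (1 / (2 * θ t ^ 2) * a t + 2 * ((1 + t) ^ 2 * e t)) := by
      simp only [hNdef]
      field_simp
      ring
    linarith
  have hθd : ∀ t ∈ Ici (0 : ℝ), HasDerivWithinAt θ (1 / (1 + t)) (Ici 0) t := fun t ht ↦
    hasDerivWithinAt_log_one_add ht
  have hθi : ∀ t ∈ Ici (0 : ℝ),
      HasDerivWithinAt (fun t ↦ (θ t)⁻¹) (-(1 / (1 + t)) / θ t ^ 2) (Ici 0) t := fun t ht ↦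
    (hθd t ht).fun_inv (hθpos t ht).ne'
  have key := div_le_div_zero_of_deriv (N := N) (D := D)
    (fun t ht ↦ ((((hasDerivWithinAt_one_add_sq t).fun_mul (h.deriv_E t ht)).const_mul 2).fun_sub
      ((((hθi t ht).const_mul 2).const_add 2).fun_mul
        ((hasDerivWithinAt_one_add t).fun_mul (h.deriv_b t ht)))).fun_add
        (((((hθi t ht).const_add (1 / 2)).fun_pow 2).const_add (1 / 4)).fun_mul (h.deriv_a t ht)))
    (fun t ht ↦ (hasDerivWithinAt_one_add t).fun_mul
      ((((hasDerivWithinAt_one_add_sq t).fun_mul ((hθd t ht).fun_pow 2)).const_mul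
        (m ^ 2)).const_add (1 / 16)))
    hDpos (fun t ht ↦ ?_) ht
  · have hlow0 := hlow t ht
    have hx : 0 < 1 + t := by linarith
    have hθ := hθpos t ht
    have hN0 : N 0 ≤ 160 * (a 0 + (E 0 - e 0)) * D 0 := by
      have h0 := h.pos 0 self_mem_Ici 1
      have hpos0 := h.pos 0 self_mem_Ici 0
      have ha0 := h.nonneg 0 self_mem_Ici
      have hup := h.upper 0 self_mem_Ici
      have hθ0 : θ 0 = 1 := by simp [hθdef]
      simp only [hNdef, hDdef, hθ0]
      have h6 : 0 ≤ (E 0 - e 0) := by linarith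
      have h8 : 0 ≤ (E 0 - e 0) * m ^ 2 := by positivity
      have h9 : 0 ≤ a 0 * m ^ 2 := by positivity
      norm_num
      nlinarith
    have h1 : N t ≤ 160 * (a 0 + (E 0 - e 0)) * D t := by
      rw [← div_le_iff₀ (hDpos t ht)]
      exact key.trans ((div_le_iff₀ (hDpos 0 self_mem_Ici)).2 hN0)
    have h2 : a t * (1 / 16 + m ^ 2 * ((1 + t) ^ 2 * θ t ^ 2)) ≤ N t * θ t ^ 2 := by
      have h3 := mul_le_mul_of_nonneg_left (h.lower t ht) (sq_nonneg ((1 + t) * θ t))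
      have h4 := h.nonneg t ht
      have h5 := mul_le_mul_of_nonneg_right hlow0 (sq_nonneg (θ t))
      have h6 : (1 / (2 * θ t ^ 2) * a t + 2 * ((1 + t) ^ 2 * e t)) * θ t ^ 2
          = a t / 2 + 2 * (((1 + t) * θ t) ^ 2 * e t) := by
        field_simp
      have h7 : 0 ≤ ((1 + t) * θ t) ^ 2 * (m ^ 2 * a t) := by positivity
      nlinarith
    have hq : 0 < 1 / 16 + m ^ 2 * ((1 + t) ^ 2 * θ t ^ 2) := by positivity
    refine le_of_mul_le_mul_right ((h2.trans (mul_le_mul_of_nonneg_right h1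
      (sq_nonneg _))).trans_eq ?_) hq
    simp only [hDdef, hθdef]
    ring
  · have hx : 0 < 1 + t := by linarith [mem_Ici.1 ht]
    have hθ := hθpos t ht
    have hup := h.upper t ht
    have hlo := h.lower t ht
    have ha := h.nonneg t ht
    have he : 0 ≤ e t := le_trans (by positivity) hlo
    have hQ := mul_nonneg (sq_nonneg (1 + t)) (h.pos t ht (-(1 / 2 + 1 / θ t) / (1 + t)))
    -- `Q` is `‖u' - u/θ‖²` times `1 + t`; it enters with the good sign.
    set Q := (1 + t) ^ 2 * (E t - e t + 2 * (-(1 / 2 + 1 / θ t) / (1 + t)) * b t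
        + (-(1 / 2 + 1 / θ t) / (1 + t)) ^ 2 * a t) with hQdef
    set N' := 2 * (2 * (1 + t) * E t + (1 + t) ^ 2 * (-2 * (1 / 4 / (1 + t) ^ 2) * b t)) -
            (2 * (-(1 / (1 + t)) / θ t ^ 2) * ((1 + t) * b t) +
              (2 + 2 * (θ t)⁻¹) * (1 * b t + (1 + t) * (E t - 2 * e t - 1 / 4 / (1 + t) ^ 2 * a t))) +
          (↑2 * (1 / 2 + (θ t)⁻¹) ^ (2 - 1) * (-(1 / (1 + t)) / θ t ^ 2) * a t +
            (1 / 4 + (1 / 2 + (θ t)⁻¹) ^ 2) * (2 * b t)) with hN'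
    have hN'eq : (1 + t) * N' = N t - 2 / θ t * Q + (2 / θ t + 4) * ((1 + t) ^ 2 * e t) := by
      rw [hN', hQdef]
      simp only [hNdef, Nat.add_one_sub_one, pow_one]
      field_simp
      ring
    set q := m ^ 2 * (1 + t) ^ 2 with hq
    have hq0 : 0 ≤ q := by positivity
    have hmain : (1 / 16 + q * θ t ^ 2) * (- (2 / θ t * Q) + (2 / θ t + 4) * ((1 + t) ^ 2 * e t))
        ≤ 2 * q * θ t * (θ t + 1) * N t := by
      have h1 : 2 * q * θ t * (θ t + 1) * (1 / (2 * θ t ^ 2) * a t + 2 * ((1 + t) ^ 2 * e t))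
          ≤ 2 * q * θ t * (θ t + 1) * N t :=
        mul_le_mul_of_nonneg_left (hlow t ht) (by positivity)
      have h2 : (1 + t) ^ 2 * e t ≤ 4 * q * a t :=
        (mul_le_mul_of_nonneg_left hup (sq_nonneg (1 + t))).trans_eq (by rw [hq]; ring)
      have h4 : 0 ≤ (1 / 16 + q * θ t ^ 2) * (2 / θ t * Q) := by positivity
      have h5 := mul_le_mul_of_nonneg_left h2 (by positivity : 0 ≤ (2 / θ t + 4) / 16)
      have h6 : 0 ≤ q * ((1 + t) ^ 2 * e t) * θ t := by positivity
      have h7 : 2 * q * θ t * (θ t + 1) * (1 / (2 * θ t ^ 2) * a t + 2 * ((1 + t) ^ 2 * e t))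
          = q * a t + q * a t / θ t + 4 * (q * ((1 + t) ^ 2 * e t)) * θ t ^ 2
            + 4 * (q * ((1 + t) ^ 2 * e t) * θ t) := by
        field_simp
        ring
      have h8 : (2 / θ t + 4) / 16 * (4 * q * a t) = q * a t / θ t / 2 + q * a t := by
        field_simp
        ring
      have h9 : q * θ t ^ 2 * ((2 / θ t + 4) * ((1 + t) ^ 2 * e t))
          = 2 * (q * ((1 + t) ^ 2 * e t) * θ t) + 4 * (q * ((1 + t) ^ 2 * e t)) * θ t ^ 2 := by
        field_simp
      have h10 : 0 ≤ q * a t / θ t := by positivity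
      linarith
    have hgoal : (1 + t) * N' * (1 / 16 + q * θ t ^ 2)
        ≤ N t * ((1 / 16 + q * θ t ^ 2) + 2 * q * θ t * (θ t + 1)) := by
      rw [hN'eq]
      linarith
    refine le_trans (le_of_eq ?_) (hgoal.trans (le_of_eq ?_))
    · simp only [hDdef]
      rw [hq]
      ring
    · rw [hq]
      simp only [Nat.add_one_sub_one, pow_one, Nat.cast_ofNat]
      field_simp

noncomputable section

/-- The growth rate of the `L²` norm of a solution. -/
def growth (μ t : ℝ) : ℝ :=
  if μ = 1 / 4 then (1 + t) ^ (1 / 2 : ℝ) * (1 + Real.log (1 + t))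
  else (1 + t) ^ (1 / 2 + (nu μ).re)

end

theorem ShellMoments.exists_growth {μ : ℝ} (hμ : 0 < μ) :
    ∃ C : ℝ, 0 < C ∧ ∀ (m : ℝ) (a b E e : ℝ → ℝ), ShellMoments μ m a b E e → ∀ t : ℝ, 0 ≤ t →
      a t ≤ C * growth μ t ^ 2 * (a 0 + (E 0 - e 0)) := by
  rcases lt_trichotomy μ (1 / 4) with h | rfl | h
  · set ν := (nu μ).re with hν
    have hνeq : ν = 1 / 2 * Real.sqrt (1 - 4 * μ) := nu_re_of_le h.le
    have hν0 : 0 < ν := by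
      rw [hνeq]
      have := Real.sqrt_pos.2 (show 0 < 1 - 4 * μ by linarith)
      positivity
    refine ⟨8 + 12 / ν ^ 2, by positivity, fun m a b E e hs t ht ↦ ?_⟩
    have hx : 0 ≤ 1 + t := by linarith
    rw [growth, if_neg h.ne, ← hν, ← Real.rpow_natCast ((1 + t) ^ (1 / 2 + ν)), ← Real.rpow_mul hx]
    convert hs.growth_of_lt hν0 (nu_re_lt_half hμ).le ?_ ht using 4
    · push_cast
      ring
    · rw [hνeq, mul_pow, Real.sq_sqrt (by linarith)]
      ring
  · refine ⟨160, by norm_num, fun m a b E e hs t ht ↦ ?_⟩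
    have hx : 0 ≤ 1 + t := by linarith
    rw [growth, if_pos rfl, mul_pow, ← Real.rpow_natCast ((1 + t) ^ (1 / 2 : ℝ)),
      ← Real.rpow_mul hx]
    convert hs.growth_of_eq ht using 4
    norm_num
  · have hκ : 0 < μ - 1 / 4 := by linarith
    refine ⟨4 + 4 * (2 + μ) / (μ - 1 / 4), by positivity, fun m a b E e hs t ht ↦ ?_⟩
    have hx : 0 ≤ 1 + t := by linarith
    rw [growth, if_neg h.ne', nu_re_of_lt h, ← Real.rpow_natCast ((1 + t) ^ (1 / 2 + 0 : ℝ)),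
      ← Real.rpow_mul hx]
    convert hs.growth_of_gt h ht using 3
    norm_num

theorem growth_nonneg (μ : ℝ) {t : ℝ} (ht : 0 ≤ t) : 0 ≤ growth μ t := by
  have := Real.log_nonneg (x := 1 + t) (by linarith)
  rw [growth]
  split_ifs <;> positivity

/-- The tail `∫ₜ^∞ (1 + s)⁻² growth(s) ds` is comparable to the decay rate. -/
theorem exists_primitive_growth {μ : ℝ} (hμ : 0 < μ) :
    ∃ (C : ℝ) (R : ℝ → ℝ), 0 < C ∧ (∀ t, 0 ≤ t → 0 ≤ R t) ∧ (∀ t, 0 ≤ t → R t ≤ C * rate μ t) ∧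
      ∀ t, 0 ≤ t → HasDerivWithinAt R (-(growth μ t / (1 + t) ^ 2)) (Ici 0) t := by
  by_cases h : μ = 1 / 4
  · refine ⟨6, fun t ↦ 2 * ((1 + t) ^ (-(1 / 2) : ℝ) * (2 + (1 + Real.log (1 + t)))), by norm_num,
      fun t ht ↦ ?_, fun t ht ↦ ?_, fun t ht ↦ ?_⟩
    · have := Real.log_nonneg (x := 1 + t) (by linarith)
      positivity
    · have := Real.log_nonneg (x := 1 + t) (by linarith)
      rw [rate, if_pos h]
      have h1 : 0 ≤ (1 + t) ^ (-(1 / 2) : ℝ) := by positivity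
      nlinarith [mul_nonneg h1 this]
    · have hx : 0 < 1 + t := by linarith
      refine (((hasDerivWithinAt_one_add_rpow (-(1 / 2)) ht).fun_mul
        ((hasDerivWithinAt_log_one_add ht).const_add 2)).const_mul 2).congr_deriv ?_
      rw [growth, if_pos h, show (1 / 2 : ℝ) = -(1 / 2) + 1 by norm_num, Real.rpow_add_one hx.ne']
      norm_num
      field_simp
      ring
  · have hν := nu_re_lt_half hμ
    have hν' : 0 < 1 / 2 - (nu μ).re := by linarith
    refine ⟨(1 / 2 - (nu μ).re)⁻¹,
      fun t ↦ (1 / 2 - (nu μ).re)⁻¹ * (1 + t) ^ (-(1 / 2) + (nu μ).re), by positivity,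
      fun t ht ↦ by positivity, fun t ht ↦ ?_, fun t ht ↦ ?_⟩
    · rw [rate, if_neg h]
    · have hx : 0 < 1 + t := by linarith
      refine ((hasDerivWithinAt_one_add_rpow (-(1 / 2) + (nu μ).re) ht).const_mul
        (1 / 2 - (nu μ).re)⁻¹).congr_deriv ?_
      rw [growth, if_neg h, show 1 / 2 + (nu μ).re = (-(1 / 2) + (nu μ).re) + 1 by ring,
        Real.rpow_add_one hx.ne', show -(1 / 2) + (nu μ).re = -(1 / 2 - (nu μ).re) by ring]
      generalize 1 / 2 - (nu μ).re = k at hν' ⊢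
      field_simp

/-! ### The equation on the Fourier side -/

open FourierTransform Filter
open scoped InnerProductSpace ComplexConjugate

noncomputable section

/-- The symbol `2π‖ξ‖` of `|∇|`. -/
def freq {d : ℕ} (ξ : Space d) : ℝ := 2 * Real.pi * ‖ξ‖

/-- Bounded measurable symbols. -/
def BddSymbol {d : ℕ} (m : Space d → ℂ) : Prop := Measurable m ∧ ∃ C : ℝ, ∀ ξ, ‖m ξ‖ ≤ C

theorem BddSymbol.memLp {d : ℕ} {m : Space d → ℂ} (hm : BddSymbol m) : MemLp m ∞ volume := by
  obtain ⟨h, C, hC⟩ := hm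
  exact memLp_top_of_bound h.aestronglyMeasurable C (Eventually.of_forall hC)

open Classical in
/-- Multiplication by a bounded measurable symbol `m` as an operator on `L²`; zero if `m` is not
such a symbol. -/
def mulOp {d : ℕ} (m : Space d → ℂ) : L2 d →L[ℂ] L2 d :=
  if h : BddSymbol m then
    (ContinuousLinearMap.mul ℂ ℂ).holderL volume ∞ 2 2 (h.memLp.toLp m)
  else 0

end

theorem freq_nonneg {d : ℕ} (ξ : Space d) : 0 ≤ freq ξ := by
  unfold freq
  positivity

theorem measurable_freq {d : ℕ} : Measurable (freq : Space d → ℝ) := by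
  unfold freq
  fun_prop

theorem BddSymbol.mul {d : ℕ} {a b : Space d → ℂ} (ha : BddSymbol a) (hb : BddSymbol b) :
    BddSymbol (fun ξ ↦ a ξ * b ξ) := by
  obtain ⟨h, C, hC⟩ := ha
  obtain ⟨h', C', hC'⟩ := hb
  refine ⟨h.mul h', C * C', fun ξ ↦ ?_⟩
  rw [norm_mul]
  exact mul_le_mul (hC ξ) (hC' ξ) (norm_nonneg _) ((norm_nonneg _).trans (hC ξ))

theorem mulOp_coeFn {d : ℕ} {m : Space d → ℂ} (hm : BddSymbol m) (f : L2 d) :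
    mulOp m f =ᵐ[volume] fun ξ ↦ m ξ * f ξ := by
  rw [mulOp, dif_pos hm]
  have h1 := (ContinuousLinearMap.mul ℂ ℂ).coeFn_holder (r := 2) (μ := volume) (hm.memLp.toLp m) f
  filter_upwards [h1, hm.memLp.coeFn_toLp] with ξ h2 h3
  have h2' : (((ContinuousLinearMap.mul ℂ ℂ).holderL volume ∞ 2 2 (hm.memLp.toLp m)) f : L2 d) ξ
    = hm.memLp.toLp m ξ * f ξ := h2
  rw [h2', h3]

theorem mulOp_mulOp {d : ℕ} {a b : Space d → ℂ} (ha : BddSymbol a) (hb : BddSymbol b) (f : L2 d) :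
    mulOp a (mulOp b f) = mulOp (fun ξ ↦ a ξ * b ξ) f := by
  apply Lp.ext
  filter_upwards [mulOp_coeFn ha (mulOp b f), mulOp_coeFn hb f, mulOp_coeFn (ha.mul hb) f]
    with ξ h1 h2 h3
  rw [h1, h2, h3, mul_assoc]

theorem norm_mulOp_le_mulOp {d : ℕ} {a b : Space d → ℂ} (ha : BddSymbol a) (hb : BddSymbol b)
    {C : ℝ} (h : ∀ ξ, ‖a ξ‖ ≤ C * ‖b ξ‖) (f : L2 d) : ‖mulOp a f‖ ≤ C * ‖mulOp b f‖ := by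
  refine Lp.norm_le_mul_norm_of_ae_le_mul ?_
  filter_upwards [mulOp_coeFn ha f, mulOp_coeFn hb f] with ξ h1 h2
  rw [h1, h2, norm_mul, norm_mul, ← mul_assoc]
  exact mul_le_mul_of_nonneg_right (h ξ) (norm_nonneg _)

theorem norm_mulOp_le {d : ℕ} {a : Space d → ℂ} (ha : BddSymbol a)
    {C : ℝ} (h : ∀ ξ, ‖a ξ‖ ≤ C) (f : L2 d) : ‖mulOp a f‖ ≤ C * ‖f‖ := by
  refine Lp.norm_le_mul_norm_of_ae_le_mul ?_
  filter_upwards [mulOp_coeFn ha f] with ξ h1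
  rw [h1, norm_mul]
  exact mul_le_mul_of_nonneg_right (h ξ) (norm_nonneg _)

/-- Multiplication by a real symbol is symmetric. -/
theorem inner_mulOp {d : ℕ} {a : Space d → ℝ} (ha : BddSymbol (fun ξ ↦ (a ξ : ℂ))) (f g : L2 d) :
    ⟪mulOp (fun ξ ↦ (a ξ : ℂ)) f, g⟫_ℂ = ⟪f, mulOp (fun ξ ↦ (a ξ : ℂ)) g⟫_ℂ := by
  rw [L2.inner_def, L2.inner_def]
  refine integral_congr_ae ?_
  filter_upwards [mulOp_coeFn ha f, mulOp_coeFn ha g] with ξ h1 h2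
  rw [h1, h2]
  simp
  ring

theorem BddSymbol.comp_sub {d : ℕ} {a b : Space d → ℂ} (ha : BddSymbol a) (hb : BddSymbol b)
    (c : ℂ) : BddSymbol (fun ξ ↦ a ξ - c * b ξ) := by
  obtain ⟨h, C, hC⟩ := ha
  obtain ⟨h', C', hC'⟩ := hb
  refine ⟨h.sub (h'.const_mul c), C + ‖c‖ * C', fun ξ ↦ ?_⟩
  refine (norm_sub_le _ _).trans (add_le_add (hC ξ) ?_)
  rw [norm_mul]
  exact mul_le_mul_of_nonneg_left (hC' ξ) (norm_nonneg _)

theorem mulOp_sub_mul {d : ℕ} {a b : Space d → ℂ} (ha : BddSymbol a) (hb : BddSymbol b)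
    (c : ℂ) (f : L2 d) :
    mulOp (fun ξ ↦ a ξ - c * b ξ) f = mulOp a f - c • mulOp b f := by
  apply Lp.ext
  filter_upwards [mulOp_coeFn (ha.comp_sub hb c) f, mulOp_coeFn ha f, mulOp_coeFn hb f,
    Lp.coeFn_sub (mulOp a f) (c • mulOp b f), Lp.coeFn_smul c (mulOp b f)] with ξ h1 h2 h3 h4 h5
  rw [h1, h4, Pi.sub_apply, h5, Pi.smul_apply, h2, h3, smul_eq_mul]
  ring

/-- A family of symbols with a uniform first order Taylor expansion is differentiable in the
operator norm. -/
theorem hasDerivAt_mulOp {d : ℕ} {m : ℝ → Space d → ℂ} {m' : Space d → ℂ} {t C : ℝ}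
    (hm : ∀ s, BddSymbol (m s)) (hm' : BddSymbol m')
    (h : ∀ s ξ, ‖m s ξ - m t ξ - (s - t : ℝ) * m' ξ‖ ≤ C * (s - t) ^ 2) :
    HasDerivAt (fun s ↦ mulOp (m s)) (mulOp m') t := by
  rw [hasDerivAt_iff_isLittleO]
  have hC : 0 ≤ C := by simpa using (norm_nonneg _).trans (h (t + 1) 0)
  refine Asymptotics.IsBigO.trans_isLittleO (g := fun s ↦ (s - t) ^ 2) ?_ ?_
  · refine Asymptotics.IsBigO.of_bound C (Eventually.of_forall fun s ↦ ?_)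
    rw [Real.norm_of_nonneg (sq_nonneg _)]
    refine ContinuousLinearMap.opNorm_le_bound _ (by positivity) fun f ↦ ?_
    have h1 : BddSymbol (fun ξ ↦ m s ξ - m t ξ) := by simpa using (hm s).comp_sub (hm t) 1
    have h2 : (mulOp (m s) - mulOp (m t) - (s - t) • mulOp m') f
        = mulOp (fun ξ ↦ m s ξ - m t ξ - ((s - t : ℝ) : ℂ) * m' ξ) f := by
      rw [mulOp_sub_mul h1 hm']
      have h3 := mulOp_sub_mul (hm s) (hm t) 1 f
      simp only [one_mul, one_smul] at h3
      rw [h3]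
      rfl
    rw [h2]
    exact norm_mulOp_le (h1.comp_sub hm' _) (h s) f
  · have := (Asymptotics.isLittleO_pow_id (n := 2) (𝕜 := ℝ) one_lt_two).comp_tendsto
      (k := fun s : ℝ ↦ s - t) (l' := nhds t) (by
        have : Tendsto (fun s : ℝ ↦ s - t) (nhds t) (nhds (t - t)) :=
          (continuous_id.sub continuous_const).tendsto t
        simpa using this)
    simpa [Function.comp_def] using this

/-- A function all of whose scalar components `L i ∘ X`, for a separating family of functionals,
are differentiable in the interior is differentiable if the candidate derivative is continuous. -/
theorem hasDerivWithinAt_of_weak {E ι : Type*} [NormedAddCommGroup E] [NormedSpace ℂ E]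
    [CompleteSpace E] {L : ι → E →L[ℂ] ℂ} (hsep : ∀ f, (∀ i, L i f = 0) → f = 0) {X Y : ℝ → E}
    (hX : ContinuousOn X (Ici 0)) (hY : ContinuousOn Y (Ici 0))
    (h : ∀ i, ∀ t ∈ Ioi (0 : ℝ), HasDerivAt (fun s ↦ L i (X s)) (L i (Y t)) t)
    {t : ℝ} (ht : t ∈ Ici (0 : ℝ)) : HasDerivWithinAt X (Y t) (Ici 0) t := by
  let _ : NormedSpace ℝ E := NormedSpace.restrictScalars ℝ ℂ E
  have hZ : Continuous (fun s : ℝ ↦ Y (max 0 s)) :=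
    hY.comp_continuous (by fun_prop) fun s ↦ le_max_left (0 : ℝ) s
  have hprim : ∀ t ∈ Ici (0 : ℝ), X t = X 0 + ∫ s in (0 : ℝ)..t, Y (max 0 s) := by
    intro t ht
    rw [← sub_eq_iff_eq_add', ← sub_eq_zero]
    refine hsep _ fun i ↦ ?_
    have h1 : ∫ s in (0 : ℝ)..t, L i (Y (max 0 s)) = L i (X t) - L i (X 0) := by
      refine intervalIntegral.integral_eq_sub_of_hasDerivAt_of_le (f := fun s ↦ L i (X s))
        (f' := fun s ↦ L i (Y (max 0 s))) ht ?_ (fun s hs ↦ ?_)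
        (((L i).continuous.comp hZ).intervalIntegrable _ _)
      · exact (L i).continuous.comp_continuousOn (hX.mono fun s hs ↦ hs.1)
      · rw [max_eq_right hs.1.le]
        exact h i s hs.1
    have h2 : ∫ s in (0 : ℝ)..t, L i (Y (max 0 s)) = L i (∫ s in (0 : ℝ)..t, Y (max 0 s)) :=
      (L i).intervalIntegral_comp_comm (hZ.intervalIntegrable _ _)
    rw [map_sub, map_sub, ← h2, h1, sub_self]
  have hd := ((intervalIntegral.integral_hasDerivAt_right (hZ.intervalIntegrable 0 t)
    hZ.stronglyMeasurable.stronglyMeasurableAtFilter hZ.continuousAt).const_add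
      (X 0)).hasDerivWithinAt (s := Ici 0)
  rw [max_eq_right ht] at hd
  exact hd.congr hprim (hprim t ht)

theorem _root_.ContinuousLinearMap.hasDerivWithinAt_comp {E F : Type*} [NormedAddCommGroup E]
    [NormedSpace ℂ E] [NormedAddCommGroup F] [NormedSpace ℂ F] (L : E →L[ℂ] F) {f : ℝ → E} {f' : E}
    {s : Set ℝ} {t : ℝ} (hf : HasDerivWithinAt f f' s t) :
    HasDerivWithinAt (fun t ↦ L (f t)) (L f') s t :=
  (L.restrictScalars ℝ).hasFDerivAt.comp_hasDerivWithinAt t hf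

/-- The equation on the Fourier side. The equation for the velocity is asserted after
multiplication by any symbol that makes `|∇|²` bounded. -/
structure FourierSolution {d : ℕ} (μ : ℝ) (V W : ℝ → L2 d) : Prop where
  deriv_V : ∀ t ∈ Ici (0 : ℝ), HasDerivWithinAt V (W t) (Ici 0) t
  deriv_W : ∀ χ : Space d → ℂ, BddSymbol χ → BddSymbol (fun ξ ↦ (freq ξ : ℂ) ^ 2 * χ ξ) →
    ∀ t ∈ Ici (0 : ℝ), HasDerivWithinAt (fun s ↦ mulOp χ (W s))
      (-mulOp (fun ξ ↦ (freq ξ : ℂ) ^ 2 * χ ξ) (V t)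
        - ((μ / (1 + t) ^ 2 : ℝ) : ℂ) • mulOp χ (V t)) (Ici 0) t
  memLp : ∀ t ∈ Ici (0 : ℝ), ∃ U : L2 d, U =ᵐ[volume] fun ξ ↦ (freq ξ : ℂ) * V t ξ

noncomputable section

/-- Pairing of `L²` functions with a fixed Schwartz function. -/
def pairing {d : ℕ} (φ : 𝓢(Space d, ℂ)) : L2 d →L[ℂ] ℂ :=
  PointwiseConvergenceCLM.evalCLM (RingHom.id ℂ) ℂ φ ∘L
    Lp.toTemperedDistributionCLM ℂ (volume : Measure (Space d)) 2

/-- The symbol `(1 + ‖ξ‖²)⁻¹`. -/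
def resolventSymbol {d : ℕ} (ξ : Space d) : ℂ := (((1 + ‖ξ‖ ^ 2) ^ (-1 : ℝ) : ℝ) : ℂ)

end

theorem pairing_apply {d : ℕ} (φ : 𝓢(Space d, ℂ)) (f : L2 d) :
    pairing φ f = (f : 𝓢'(Space d, ℂ)) φ := rfl

theorem eq_zero_of_pairing {d : ℕ} (f : L2 d) (h : ∀ φ, pairing φ f = 0) : f = 0 := by
  have hk := Lp.ker_toTemperedDistributionCLM_eq_bot (F := ℂ) (μ := (volume : Measure (Space d)))
    (p := 2)
  have : f ∈ (Lp.toTemperedDistributionCLM ℂ (volume : Measure (Space d)) 2).ker := by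
    rw [LinearMap.mem_ker]
    ext φ
    exact h φ
  rw [hk] at this
  simpa using this

theorem pairing_mulOp {d : ℕ} {m : Space d → ℂ} (hm : BddSymbol m) (φ : 𝓢(Space d, ℂ)) (f : L2 d) :
    pairing φ (mulOp m f) = ∫ ξ, φ ξ * (m ξ * f ξ) := by
  rw [pairing_apply, Lp.toTemperedDistribution_apply]
  refine integral_congr_ae ?_
  filter_upwards [mulOp_coeFn hm f] with ξ h
  rw [h, smul_eq_mul]

theorem resolventSymbol_eq {d : ℕ} (ξ : Space d) :
    resolventSymbol ξ = (1 + (‖ξ‖ : ℂ) ^ 2)⁻¹ := by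
  rw [resolventSymbol, Real.rpow_neg_one]
  push_cast
  rfl

theorem one_add_norm_sq_ne_zero {d : ℕ} (ξ : Space d) : (1 + (‖ξ‖ : ℂ) ^ 2) ≠ 0 := by
  have : (1 + ‖ξ‖ ^ 2 : ℝ) ≠ 0 := by positivity
  exact_mod_cast this

theorem hasTemperateGrowth_resolventSymbol {d : ℕ} :
    (resolventSymbol : Space d → ℂ).HasTemperateGrowth :=
  Function.Complex.hasTemperateGrowth_ofReal.comp
    (Function.hasTemperateGrowth_one_add_norm_sq_rpow (Space d) (-1))

theorem bddSymbol_resolventSymbol {d : ℕ} : BddSymbol (resolventSymbol : Space d → ℂ) := by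
  refine ⟨hasTemperateGrowth_resolventSymbol.1.continuous.measurable, 1, fun ξ ↦ ?_⟩
  rw [resolventSymbol, Complex.norm_real, Real.rpow_neg_one, norm_inv,
    Real.norm_of_nonneg (by positivity)]
  exact inv_le_one_of_one_le₀ (by simp)

theorem bddSymbol_freq_sq_resolventSymbol {d : ℕ} :
    BddSymbol (fun ξ : Space d ↦ (freq ξ : ℂ) ^ 2 * resolventSymbol ξ) := by
  refine ⟨((Complex.measurable_ofReal.comp measurable_freq).pow_const 2).mul
    bddSymbol_resolventSymbol.1, (2 * Real.pi) ^ 2, fun ξ ↦ ?_⟩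
  rw [norm_mul, resolventSymbol, Complex.norm_real, Real.rpow_neg_one, norm_inv, norm_pow,
    Complex.norm_real, Real.norm_of_nonneg (freq_nonneg ξ),
    Real.norm_of_nonneg (by positivity : 0 ≤ 1 + ‖ξ‖ ^ 2), freq, ← div_eq_mul_inv,
    div_le_iff₀ (by positivity), mul_pow]
  have : 0 < (2 * Real.pi) ^ 2 := by positivity
  nlinarith

/-- If multiplication by a symbol of temperate growth carries one `L²` function to another as
tempered distributions, then it does so almost everywhere. -/
theorem coeFn_ae_eq_of_smulLeftCLM {d : ℕ} {m : Space d → ℂ} (hm : m.HasTemperateGrowth)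
    (hb : BddSymbol (fun ξ ↦ m ξ * resolventSymbol ξ)) {F V : L2 d}
    (h : (F : 𝓢'(Space d, ℂ)) = TemperedDistribution.smulLeftCLM ℂ m (V : 𝓢'(Space d, ℂ))) :
    F =ᵐ[volume] fun ξ ↦ m ξ * V ξ := by
  have key : mulOp resolventSymbol F = mulOp (fun ξ ↦ m ξ * resolventSymbol ξ) V := by
    rw [← sub_eq_zero]
    refine eq_zero_of_pairing _ fun φ ↦ ?_
    have h1 := congrArg (fun T : 𝓢'(Space d, ℂ) ↦
      T (SchwartzMap.smulLeftCLM ℂ (resolventSymbol (d := d)) φ)) h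
    simp only [TemperedDistribution.smulLeftCLM_apply_apply, Lp.toTemperedDistribution_apply] at h1
    rw [map_sub, pairing_mulOp bddSymbol_resolventSymbol, pairing_mulOp hb, sub_eq_zero]
    refine Eq.trans (integral_congr_ae (Eventually.of_forall fun ξ ↦ ?_)) (h1.trans
      (integral_congr_ae (Eventually.of_forall fun ξ ↦ ?_)))
    · simp only [SchwartzMap.smulLeftCLM_apply_apply hasTemperateGrowth_resolventSymbol,
        smul_eq_mul]
      ring
    · simp only [SchwartzMap.smulLeftCLM_apply_apply hasTemperateGrowth_resolventSymbol,
        SchwartzMap.smulLeftCLM_apply_apply hm, smul_eq_mul]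
      ring
  filter_upwards [mulOp_coeFn bddSymbol_resolventSymbol F, mulOp_coeFn hb V] with ξ h1 h2
  rw [key, h2, resolventSymbol_eq] at h1
  have := one_add_norm_sq_ne_zero ξ
  field_simp at h1
  exact h1.symm

theorem abs_inner_e_le {d : ℕ} (i : Fin d) (ξ : Space d) : |inner ℝ ξ (e i : Space d)| ≤ ‖ξ‖ := by
  have := abs_real_inner_le_norm ξ (e i : Space d)
  simpa [e] using this

theorem hasTemperateGrowth_partialSymbol {d : ℕ} (i : Fin d) :
    (fun ξ : Space d ↦ 2 * Real.pi * Complex.I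
      * ((inner ℝ ξ (e i : Space d) : ℝ) : ℂ)).HasTemperateGrowth := by
  fun_prop

theorem fourier_lineDerivOp {d : ℕ} (i : Fin d) (f : 𝓢'(Space d, ℂ)) :
    𝓕 (∂_{(e i : Space d)} f) = TemperedDistribution.smulLeftCLM ℂ
      (fun ξ : Space d ↦ 2 * Real.pi * Complex.I * ((inner ℝ ξ (e i : Space d) : ℝ) : ℂ))
      (𝓕 f) := by
  have hg : (fun ξ : Space d ↦ ((inner ℝ ξ (e i : Space d) : ℝ) : ℂ)).HasTemperateGrowth := by
    fun_prop
  rw [TemperedDistribution.fourier_lineDerivOp_eq]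
  have := TemperedDistribution.smulLeftCLM_smul (F := ℂ) hg (2 * Real.pi * Complex.I)
  exact (DFunLike.congr_fun this (𝓕 f)).symm

theorem bddSymbol_partialSymbol_resolventSymbol {d : ℕ} (i : Fin d) :
    BddSymbol (fun ξ : Space d ↦ 2 * Real.pi * Complex.I
      * ((inner ℝ ξ (e i : Space d) : ℝ) : ℂ) * resolventSymbol ξ) := by
  refine ⟨(hasTemperateGrowth_partialSymbol i).1.continuous.measurable.mul
    bddSymbol_resolventSymbol.1, 2 * Real.pi, fun ξ ↦ ?_⟩
  have h1 := abs_inner_e_le i ξ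
  have h2 : 0 < 1 + ‖ξ‖ ^ 2 := by positivity
  rw [norm_mul, resolventSymbol, Complex.norm_real, Real.rpow_neg_one, norm_inv,
    Real.norm_of_nonneg h2.le, ← div_eq_mul_inv, div_le_iff₀ h2, norm_mul, Complex.norm_real,
    Real.norm_eq_abs]
  have h3 : ‖(2 * Real.pi * Complex.I : ℂ)‖ = 2 * Real.pi := by
    simp [abs_of_pos Real.pi_pos]
  rw [h3]
  have hpi := Real.pi_pos
  gcongr
  nlinarith [sq_nonneg (‖ξ‖ - 1)]

/-- The frequency variable times the Fourier transform of a function with square integrable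
gradient is square integrable. -/
theorem exists_freq_mul {d : ℕ} {f : L2 d} (G : Fin d → L2 d)
    (hG : ∀ i, ∂_{(e i : Space d)} (f : 𝓢'(Space d, ℂ)) = (G i : 𝓢'(Space d, ℂ))) :
    ∃ U : L2 d, U =ᵐ[volume] fun ξ ↦ (freq ξ : ℂ) * (𝓕 f : L2 d) ξ := by
  have hG' : ∀ i, (𝓕 (G i) : L2 d) =ᵐ[volume] fun ξ ↦ 2 * Real.pi * Complex.I
      * ((inner ℝ ξ (e i : Space d) : ℝ) : ℂ) * (𝓕 f : L2 d) ξ := fun i ↦ by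
    refine coeFn_ae_eq_of_smulLeftCLM (hasTemperateGrowth_partialSymbol i)
      (bddSymbol_partialSymbol_resolventSymbol i) ?_
    rw [← Lp.fourier_toTemperedDistribution_eq, ← hG, fourier_lineDerivOp,
      Lp.fourier_toTemperedDistribution_eq]
  have hsum : MemLp (fun ξ ↦ ∑ i, ‖(𝓕 (G i) : L2 d) ξ‖) 2 (volume : Measure (Space d)) :=
    memLp_finsetSum _ fun i _ ↦ (Lp.memLp (𝓕 (G i) : L2 d)).norm
  have hmem : MemLp (fun ξ ↦ (freq ξ : ℂ) * (𝓕 f : L2 d) ξ) 2 (volume : Measure (Space d)) := by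
    refine hsum.of_le ((Complex.measurable_ofReal.comp measurable_freq).aestronglyMeasurable.mul
      (Lp.aestronglyMeasurable _)) ?_
    filter_upwards [eventually_all.2 hG'] with ξ h
    rw [Real.norm_of_nonneg (Finset.sum_nonneg fun _ _ ↦ norm_nonneg _)]
    simp only [h, norm_mul, Complex.norm_real, Complex.norm_I, mul_one, Complex.norm_ofNat,
      ← Finset.sum_mul]
    rw [← Finset.mul_sum, Real.norm_of_nonneg (freq_nonneg ξ), freq,
      Real.norm_of_nonneg Real.pi_pos.le]
    have hpi := Real.pi_pos
    gcongr
    have h1 : ξ = ∑ i, ξ i • (e i : Space d) := by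
      have := (EuclideanSpace.basisFun (Fin d) ℝ).sum_repr ξ
      simpa [e] using this.symm
    conv_lhs => rw [h1]
    refine (norm_sum_le _ _).trans (Finset.sum_le_sum fun i _ ↦ ?_)
    simp [e, norm_smul, EuclideanSpace.inner_single_right]
  exact ⟨hmem.toLp _, hmem.coeFn_toLp⟩

/-- The weak form of the equation on the Fourier side, tested against `resolventSymbol * φ`. -/
theorem IsSolution.hasDerivAt_pairing {d : ℕ} {μ : ℝ} {v₀ v₁ : L2 d} {v w : ℝ → L2 d}
    (h : IsSolution μ v₀ v₁ v w) (φ : 𝓢(Space d, ℂ)) {t : ℝ} (ht : t ∈ Ioi (0 : ℝ)) :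
    HasDerivAt (fun s ↦ pairing φ (mulOp resolventSymbol (𝓕 (w s))))
      (pairing φ (-mulOp (fun ξ ↦ (freq ξ : ℂ) ^ 2 * resolventSymbol ξ) (𝓕 (v t))
        - ((μ / (1 + t) ^ 2 : ℝ) : ℂ) • mulOp resolventSymbol (𝓕 (v t)))) t := by
  set ψ := SchwartzMap.smulLeftCLM ℂ (resolventSymbol (d := d)) φ with hψ
  have hF : ∀ f : L2 d, pairing φ (mulOp resolventSymbol (𝓕 f))
      = (f : 𝓢'(Space d, ℂ)) (𝓕 ψ) := by
    intro f
    rw [← TemperedDistribution.fourier_apply, Lp.fourier_toTemperedDistribution_eq,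
      pairing_mulOp bddSymbol_resolventSymbol, Lp.toTemperedDistribution_apply]
    refine integral_congr_ae (Eventually.of_forall fun ξ ↦ ?_)
    simp only [hψ, SchwartzMap.smulLeftCLM_apply_apply hasTemperateGrowth_resolventSymbol,
      smul_eq_mul]
    ring
  have hL : pairing φ (mulOp (fun ξ ↦ (freq ξ : ℂ) ^ 2 * resolventSymbol ξ) (𝓕 (v t)))
      = -(v t : 𝓢'(Space d, ℂ)) (Δ (𝓕 ψ)) := by
    have hg : (fun x : Space d ↦ Complex.ofReal (‖x‖ ^ 2)).HasTemperateGrowth := by fun_prop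
    rw [← TemperedDistribution.laplacian_apply_apply,
      TemperedDistribution.laplacian_eq_fourierMultiplierCLM]
    have h1 : (TemperedDistribution.fourierMultiplierCLM ℂ
        (fun x : Space d ↦ Complex.ofReal (‖x‖ ^ 2)) (v t : 𝓢'(Space d, ℂ))) (𝓕 ψ)
        = (𝓕 (v t : 𝓢'(Space d, ℂ))) (SchwartzMap.smulLeftCLM ℂ
          (fun x : Space d ↦ Complex.ofReal (‖x‖ ^ 2)) ψ) := by
      simp
    have h2 : ((-(2 * Real.pi) ^ 2 • TemperedDistribution.fourierMultiplierCLM ℂ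
        (fun x : Space d ↦ Complex.ofReal (‖x‖ ^ 2)) (v t : 𝓢'(Space d, ℂ)) :
          𝓢'(Space d, ℂ)) (𝓕 ψ))
        = -(2 * Real.pi) ^ 2 • (TemperedDistribution.fourierMultiplierCLM ℂ
        (fun x : Space d ↦ Complex.ofReal (‖x‖ ^ 2)) (v t : 𝓢'(Space d, ℂ))) (𝓕 ψ) := rfl
    rw [h2, h1, Lp.fourier_toTemperedDistribution_eq,
      pairing_mulOp bddSymbol_freq_sq_resolventSymbol, Lp.toTemperedDistribution_apply,
      ← integral_smul, ← integral_neg]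
    refine integral_congr_ae (Eventually.of_forall fun ξ ↦ ?_)
    simp only [hψ, SchwartzMap.smulLeftCLM_apply_apply hasTemperateGrowth_resolventSymbol,
      SchwartzMap.smulLeftCLM_apply_apply hg, smul_eq_mul, freq, Complex.real_smul]
    push_cast
    ring
  simp only [hF, map_sub, map_neg, hL, map_smul, smul_eq_mul, neg_neg]
  exact h.equation (𝓕 ψ) t ht

/-- The distributional equation holds strongly in `L²` after multiplication by the symbol
`(1 + ‖ξ‖²)⁻¹`, which makes `|∇|²` bounded. -/
theorem IsSolution.hasDerivWithinAt_resolvent {d : ℕ} {μ : ℝ} {v₀ v₁ : L2 d} {v w : ℝ → L2 d}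
    (h : IsSolution μ v₀ v₁ v w) {t : ℝ} (ht : t ∈ Ici (0 : ℝ)) :
    HasDerivWithinAt (fun s ↦ mulOp resolventSymbol (𝓕 (w s)))
        (-mulOp (fun ξ ↦ (freq ξ : ℂ) ^ 2 * resolventSymbol ξ) (𝓕 (v t))
          - ((μ / (1 + t) ^ 2 : ℝ) : ℂ) • mulOp resolventSymbol (𝓕 (v t))) (Ici 0) t := by
  have hcont : ContinuousOn (fun t ↦ 𝓕 (v t)) (Ici (0 : ℝ)) := fun t ht ↦
    ((fourierCLM ℂ (L2 d)).hasDerivWithinAt_comp (h.hasDeriv t ht)).continuousWithinAt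
  have hcontw : ContinuousOn (fun t ↦ 𝓕 (w t)) (Ici (0 : ℝ)) :=
    (fourierCLM ℂ (L2 d)).continuous.comp_continuousOn h.continuousOn_deriv
  have hop : ∀ m : Space d → ℂ, ContinuousOn (fun t ↦ mulOp m (𝓕 (v t))) (Ici (0 : ℝ)) := fun m ↦
    (mulOp m).continuous.comp_continuousOn hcont
  have hc : ContinuousOn (fun t : ℝ ↦ ((μ / (1 + t) ^ 2 : ℝ) : ℂ)) (Ici (0 : ℝ)) := by
    refine Complex.continuous_ofReal.comp_continuousOn
      (continuousOn_const.div (by fun_prop) fun s hs ↦ ?_)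
    have : 0 < 1 + s := by linarith [mem_Ici.1 hs]
    positivity
  exact hasDerivWithinAt_of_weak (L := pairing) eq_zero_of_pairing
    (Y := fun t ↦ -mulOp (fun ξ ↦ (freq ξ : ℂ) ^ 2 * resolventSymbol ξ) (𝓕 (v t))
      - ((μ / (1 + t) ^ 2 : ℝ) : ℂ) • mulOp resolventSymbol (𝓕 (v t)))
    ((mulOp _).continuous.comp_continuousOn hcontw) ((hop _).neg.sub (hc.smul (hop _)))
    (fun φ t ht ↦ h.hasDerivAt_pairing φ ht) ht

/-- The Fourier transform of a finite energy solution solves the equation on the Fourier side. -/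
theorem IsSolution.fourierSolution {d : ℕ} {μ : ℝ} {v₀ v₁ : L2 d} {v w : ℝ → L2 d}
    (h : IsSolution μ v₀ v₁ v w) : FourierSolution μ (fun t ↦ 𝓕 (v t)) (fun t ↦ 𝓕 (w t)) := by
  refine ⟨fun t ht ↦ (fourierCLM ℂ (L2 d)).hasDerivWithinAt_comp (h.hasDeriv t ht), ?_, ?_⟩
  · intro χ hχ hχ' t ht
    -- A symbol `χ` for which `|∇|² χ` is bounded is a bounded multiple of `resolventSymbol`.
    have hb : BddSymbol (fun ξ ↦ χ ξ * (1 + (‖ξ‖ : ℂ) ^ 2)) := by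
      have := hχ.comp_sub hχ' (-((2 * Real.pi : ℝ) : ℂ)⁻¹ ^ 2)
      refine (congrArg BddSymbol (funext fun ξ ↦ ?_)).mp this
      have hpi : ((2 * Real.pi : ℝ) : ℂ) ≠ 0 := by exact_mod_cast (by positivity : 2 * Real.pi ≠ 0)
      rw [freq]
      push_cast at hpi ⊢
      field_simp
      ring
    have hW : ∀ f : L2 d, mulOp χ f
        = mulOp (fun ξ ↦ χ ξ * (1 + (‖ξ‖ : ℂ) ^ 2)) (mulOp resolventSymbol f) := by
      intro f
      rw [mulOp_mulOp hb bddSymbol_resolventSymbol]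
      congr 2
      ext ξ
      rw [resolventSymbol_eq, mul_assoc, mul_inv_cancel₀ (one_add_norm_sq_ne_zero ξ), mul_one]
    have hV : ∀ f : L2 d, mulOp (fun ξ ↦ (freq ξ : ℂ) ^ 2 * χ ξ) f
        = mulOp (fun ξ ↦ χ ξ * (1 + (‖ξ‖ : ℂ) ^ 2))
          (mulOp (fun ξ ↦ (freq ξ : ℂ) ^ 2 * resolventSymbol ξ) f) := by
      intro f
      rw [mulOp_mulOp hb bddSymbol_freq_sq_resolventSymbol]
      congr 2
      ext ξ
      rw [resolventSymbol_eq]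
      field_simp [one_add_norm_sq_ne_zero ξ]
    have := (mulOp (fun ξ ↦ χ ξ * (1 + (‖ξ‖ : ℂ) ^ 2))).hasDerivWithinAt_comp
      (h.hasDerivWithinAt_resolvent ht)
    simp only [map_sub, map_neg, map_smul, ← hW, ← hV] at this
    exact this
  · intro t ht
    choose G _ hG using h.continuousOn_grad
    exact exists_freq_mul (fun i ↦ G i t) fun i ↦ hG i t ht

/-! ### Decomposition into dyadic shells -/

noncomputable section

/-- The indicator function of `S` as a symbol. -/
def cutoff {d : ℕ} (S : Set (Space d)) (ξ : Space d) : ℝ := S.indicator 1 ξ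

end

theorem cutoff_of_mem {d : ℕ} {S : Set (Space d)} {ξ : Space d} (h : ξ ∈ S) : cutoff S ξ = 1 := by
  simp [cutoff, h]

theorem cutoff_of_notMem {d : ℕ} {S : Set (Space d)} {ξ : Space d} (h : ξ ∉ S) :
    cutoff S ξ = 0 := by
  simp [cutoff, h]

theorem cutoff_mul_cutoff {d : ℕ} (S : Set (Space d)) (ξ : Space d) :
    cutoff S ξ * cutoff S ξ = cutoff S ξ := by
  by_cases h : ξ ∈ S <;> simp [cutoff, h]

theorem norm_mul_cutoff_le {d : ℕ} {S : Set (Space d)} {k : Space d → ℂ} {C : ℝ} (hC : 0 ≤ C)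
    (h : ∀ ξ ∈ S, ‖k ξ‖ ≤ C) (ξ : Space d) : ‖k ξ * (cutoff S ξ : ℂ)‖ ≤ C := by
  by_cases hξ : ξ ∈ S
  · simpa [cutoff_of_mem hξ] using h ξ hξ
  · simpa [cutoff_of_notMem hξ] using hC

theorem measurable_cutoff {d : ℕ} {S : Set (Space d)} (hS : MeasurableSet S) :
    Measurable (cutoff S) :=
  measurable_one.indicator hS

theorem bddSymbol_mul_cutoff {d : ℕ} {S : Set (Space d)} (hS : MeasurableSet S) {k : Space d → ℂ}
    (hk : Measurable k) {C : ℝ} (hC : 0 ≤ C) (h : ∀ ξ ∈ S, ‖k ξ‖ ≤ C) :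
    BddSymbol (fun ξ ↦ k ξ * (cutoff S ξ : ℂ)) :=
  ⟨hk.mul (Complex.measurable_ofReal.comp (measurable_cutoff hS)), C, norm_mul_cutoff_le hC h⟩

theorem bddSymbol_cutoff {d : ℕ} {S : Set (Space d)} (hS : MeasurableSet S) :
    BddSymbol (fun ξ ↦ (cutoff S ξ : ℂ)) := by
  have := bddSymbol_mul_cutoff hS (k := fun _ ↦ 1) measurable_const zero_le_one (by simp)
  simpa using this

theorem hasDerivWithinAt_re_inner {E : Type*} [NormedAddCommGroup E] [InnerProductSpace ℂ E]
    {f g : ℝ → E} {f' g' : E} {s : Set ℝ} {t : ℝ} (hf : HasDerivWithinAt f f' s t)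
    (hg : HasDerivWithinAt g g' s t) :
    HasDerivWithinAt (fun t ↦ (⟪f t, g t⟫_ℂ).re) ((⟪f t, g'⟫_ℂ).re + (⟪f', g t⟫_ℂ).re) s t := by
  let _ : NormedSpace ℝ E := NormedSpace.restrictScalars ℝ ℂ E
  have := Complex.reCLM.hasFDerivAt.comp_hasDerivWithinAt t (hf.inner ℂ hg)
  simpa using! this

set_option maxHeartbeats 1000000 in
/-- The part of a solution in a set of frequencies between `m` and `2m` satisfies the moment
equations, with `A` the multiplication by `|∇|²`. -/
theorem FourierSolution.shellMoments {d : ℕ} {μ : ℝ} {V W : ℝ → L2 d} (h : FourierSolution μ V W)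
    {S : Set (Space d)} (hS : MeasurableSet S) {m : ℝ} (hm : 0 ≤ m) (hlow : ∀ ξ ∈ S, m ≤ freq ξ)
    (hup : ∀ ξ ∈ S, freq ξ ≤ 2 * m) :
    ShellMoments μ m (fun t ↦ ‖mulOp (fun ξ ↦ (cutoff S ξ : ℂ)) (V t)‖ ^ 2)
      (fun t ↦ (⟪mulOp (fun ξ ↦ (cutoff S ξ : ℂ)) (V t),
        mulOp (fun ξ ↦ (cutoff S ξ : ℂ)) (W t)⟫_ℂ).re)
      (fun t ↦ ‖mulOp (fun ξ ↦ (cutoff S ξ : ℂ)) (W t)‖ ^ 2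
        + ‖mulOp (fun ξ ↦ ((freq ξ * cutoff S ξ : ℝ) : ℂ)) (V t)‖ ^ 2)
      (fun t ↦ ‖mulOp (fun ξ ↦ ((freq ξ * cutoff S ξ : ℝ) : ℂ)) (V t)‖ ^ 2) := by
  set χ : Space d → ℂ := fun ξ ↦ (cutoff S ξ : ℂ) with hχdef
  set β : Space d → ℂ := fun ξ ↦ ((freq ξ * cutoff S ξ : ℝ) : ℂ) with hβdef
  have hχ : BddSymbol χ := bddSymbol_cutoff hS
  have hβ : BddSymbol β := by
    have := bddSymbol_mul_cutoff hS (k := fun ξ ↦ (freq ξ : ℂ))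
      (Complex.measurable_ofReal.comp measurable_freq) (C := 2 * m) (by positivity) (fun ξ hξ ↦ by
        rw [Complex.norm_real, Real.norm_of_nonneg (freq_nonneg ξ)]
        exact hup ξ hξ)
    simpa only [hβdef, Complex.ofReal_mul] using this
  have hββ : (fun ξ ↦ β ξ * β ξ) = fun ξ ↦ (freq ξ : ℂ) ^ 2 * χ ξ := by
    ext ξ
    simp only [hβdef, hχdef]
    rw [← Complex.ofReal_mul, mul_mul_mul_comm, cutoff_mul_cutoff]
    push_cast
    ring
  have hβχ : (fun ξ ↦ β ξ * χ ξ) = β := by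
    ext ξ
    simp only [hβdef, hχdef]
    rw [← Complex.ofReal_mul, mul_assoc, cutoff_mul_cutoff]
  have hinner : ∀ f g : L2 d, ⟪mulOp χ f, mulOp (fun ξ ↦ (freq ξ : ℂ) ^ 2 * χ ξ) g⟫_ℂ
      = ⟪mulOp β f, mulOp β g⟫_ℂ := by
    intro f g
    rw [← hββ, ← mulOp_mulOp hβ hβ, ← inner_mulOp (a := fun ξ ↦ freq ξ * cutoff S ξ) hβ,
      mulOp_mulOp hβ hχ]
    simp only [hβχ]
  have hA : BddSymbol (fun ξ ↦ (freq ξ : ℂ) ^ 2 * χ ξ) := hββ ▸ hβ.mul hβ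
  have hy : ∀ t ∈ Ici (0 : ℝ), HasDerivWithinAt (fun t ↦ mulOp χ (V t)) (mulOp χ (W t)) (Ici 0) t :=
    fun t ht ↦ (mulOp χ).hasDerivWithinAt_comp (h.deriv_V t ht)
  have hz := h.deriv_W χ hχ hA
  have hB : ∀ t ∈ Ici (0 : ℝ), HasDerivWithinAt (fun t ↦ mulOp β (V t)) (mulOp β (W t)) (Ici 0) t :=
    fun t ht ↦ (mulOp β).hasDerivWithinAt_comp (h.deriv_V t ht)
  have hsq : ∀ f : L2 d, ‖f‖ ^ 2 = (⟪f, f⟫_ℂ).re := fun f ↦ by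
    rw [inner_self_eq_norm_sq_to_K]
    norm_cast
  have hsymm : ∀ f g : L2 d, (⟪f, g⟫_ℂ).re = (⟪g, f⟫_ℂ).re := fun f g ↦ by
    rw [← inner_conj_symm, Complex.conj_re]
  have hlin : ∀ (f g k : L2 d) (c : ℝ), (⟪f, -g - (c : ℂ) • k⟫_ℂ).re
      = -(⟪f, g⟫_ℂ).re - c * (⟪f, k⟫_ℂ).re := fun f g k c ↦ by
    rw [inner_sub_right, inner_neg_right, inner_smul_right]
    simp
  refine ⟨fun t ht ↦ ?_, fun t ht ↦ ?_, fun t ht ↦ ?_, fun t ht ↦ sq_nonneg _, fun t ht ↦ ?_,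
    fun t ht ↦ ?_, fun t ht s ↦ ?_⟩
  · simp only [hsq]
    refine (hasDerivWithinAt_re_inner (hy t ht) (hy t ht)).congr_deriv ?_
    rw [hsymm (mulOp χ (W t))]
    ring
  · refine (hasDerivWithinAt_re_inner (hy t ht) (hz t ht)).congr_deriv ?_
    rw [hlin, hinner, hsq, hsq, hsq]
    ring
  · simp only [hsq]
    refine ((hasDerivWithinAt_re_inner (hz t ht) (hz t ht)).fun_add
      (hasDerivWithinAt_re_inner (hB t ht) (hB t ht))).congr_deriv ?_
    rw [hsymm _ (mulOp χ (W t)), hlin, hinner, hsymm (mulOp β (W t)), hsymm (mulOp χ (W t))]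
    ring
  · rw [← mul_pow]
    refine pow_le_pow_left₀ (by positivity) ?_ 2
    rcases hm.eq_or_lt with rfl | hm
    · simp
    · rw [← le_div_iff₀' hm, div_eq_inv_mul]
      refine norm_mulOp_le_mulOp hχ hβ (fun ξ ↦ ?_) _
      rw [← div_eq_inv_mul, le_div_iff₀ hm]
      simp only [hβdef, hχdef, Complex.norm_real]
      by_cases hξ : ξ ∈ S
      · rw [cutoff_of_mem hξ, mul_one, norm_one, one_mul, Real.norm_of_nonneg (freq_nonneg ξ)]
        exact hlow ξ hξ
      · simp [cutoff_of_notMem hξ]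
  · rw [show 4 * m ^ 2 * ‖mulOp χ (V t)‖ ^ 2 = (2 * m * ‖mulOp χ (V t)‖) ^ 2 by ring]
    refine pow_le_pow_left₀ (by positivity) (norm_mulOp_le_mulOp hβ hχ (fun ξ ↦ ?_) _) 2
    simp only [hβdef, hχdef, Complex.norm_real, norm_mul, Real.norm_of_nonneg (freq_nonneg ξ)]
    by_cases hξ : ξ ∈ S
    · exact mul_le_mul_of_nonneg_right (hup ξ hξ) (norm_nonneg _)
    · simp [cutoff_of_notMem hξ]
  -- Positivity of `‖y' + s y‖²`.
  · have h1 : 0 ≤ ‖mulOp χ (W t) + (s : ℂ) • mulOp χ (V t)‖ ^ 2 := sq_nonneg _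
    rw [hsq, inner_add_add_self] at h1
    simp only [inner_smul_left, inner_smul_right, Complex.add_re, Complex.conj_ofReal,
      Complex.re_ofReal_mul, ← hsq] at h1
    rw [hsymm (mulOp χ (W t))] at h1
    nlinarith

theorem enorm_sq_eq_lintegral {d : ℕ} (f : L2 d) : ‖f‖ₑ ^ 2 = ∫⁻ ξ, ‖f ξ‖ₑ ^ 2 := by
  have := eLpNorm_nnreal_pow_eq_lintegral (μ := (volume : Measure (Space d))) (f := f)
    (p := (2 : NNReal)) two_ne_zero
  rw [Lp.enorm_def]
  simpa using this

/-- A partition of frequency space decomposes the `L²` norm orthogonally. -/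
theorem enorm_sq_eq_tsum {d : ℕ} {ι : Type*} [Countable ι] {S : ι → Set (Space d)}
    (hS : ∀ j, MeasurableSet (S j)) (hd : Pairwise (Function.onFun Disjoint S))
    (hU : ⋃ j, S j = univ) (f : L2 d) :
    ‖f‖ₑ ^ 2 = ∑' j, ‖mulOp (fun ξ ↦ (cutoff (S j) ξ : ℂ)) f‖ₑ ^ 2 := by
  rw [enorm_sq_eq_lintegral, ← setLIntegral_univ, ← hU, lintegral_iUnion hS hd]
  refine tsum_congr fun j ↦ ?_
  rw [enorm_sq_eq_lintegral, ← lintegral_indicator (hS j)]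
  refine lintegral_congr_ae ?_
  filter_upwards [mulOp_coeFn (bddSymbol_cutoff (hS j)) f] with ξ h
  rw [h]
  by_cases hξ : ξ ∈ S j
  · simp [hξ, cutoff_of_mem]
  · simp [hξ, cutoff_of_notMem]

noncomputable section

/-- The dyadic frequency shells `2^j ≤ |∇| < 2^(j+1)`, together with the zero frequency. -/
def shell (d : ℕ) : Option ℤ → Set (Space d)
  | none => {ξ | freq ξ = 0}
  | some j => {ξ | freq ξ ∈ Ico ((2 : ℝ) ^ j) (2 ^ (j + 1))}

/-- The lower frequency of a dyadic shell. -/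
def shellFreq : Option ℤ → ℝ
  | none => 0
  | some j => 2 ^ j

end

theorem shellFreq_nonneg (j : Option ℤ) : 0 ≤ shellFreq j := by
  cases j <;> simp only [shellFreq] <;> positivity

theorem measurableSet_shell {d : ℕ} (j : Option ℤ) : MeasurableSet (shell d j) := by
  cases j with
  | none => exact measurable_freq (measurableSet_singleton 0)
  | some j => exact measurable_freq measurableSet_Ico

theorem iUnion_shell (d : ℕ) : ⋃ j, shell d j = univ := by
  refine eq_univ_of_forall fun ξ ↦ mem_iUnion.2 ?_
  rcases (freq_nonneg ξ).eq_or_lt with h | h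
  · exact ⟨none, h.symm⟩
  · obtain ⟨j, hj⟩ := exists_mem_Ico_zpow h one_lt_two
    exact ⟨some j, hj⟩

theorem pairwise_disjoint_shell (d : ℕ) : Pairwise (Function.onFun Disjoint (shell d)) := by
  have h0 : ∀ j : ℤ, Disjoint (shell d none) (shell d (some j)) := fun j ↦
    Set.disjoint_left.2 fun ξ h1 h2 ↦ by
      have h3 : (2 : ℝ) ^ j ≤ freq ξ := h2.1
      rw [show freq ξ = 0 from h1] at h3
      exact absurd h3 (not_le.2 (by positivity))
  have h1 : ∀ i j : ℤ, i < j → Disjoint (shell d (some i)) (shell d (some j)) := fun i j hij ↦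
    Set.disjoint_left.2 fun ξ h1 h2 ↦ by
      have h3 : freq ξ < 2 ^ (i + 1) := h1.2
      have h4 : (2 : ℝ) ^ j ≤ freq ξ := h2.1
      have h5 : (2 : ℝ) ^ (i + 1) ≤ 2 ^ j := zpow_le_zpow_right₀ one_le_two (by omega)
      linarith
  rintro (_ | i) (_ | j) hij
  · exact absurd rfl hij
  · exact h0 j
  · exact (h0 i).symm
  · rcases lt_trichotomy i j with h | rfl | h
    · exact h1 i j h
    · exact absurd rfl hij
    · exact (h1 j i h).symm

theorem shellFreq_le {d : ℕ} (j : Option ℤ) : ∀ ξ ∈ shell d j, shellFreq j ≤ freq ξ := by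
  intro ξ hξ
  cases j with
  | none => exact le_of_eq (Eq.symm hξ)
  | some j => exact hξ.1

theorem le_shellFreq {d : ℕ} (j : Option ℤ) : ∀ ξ ∈ shell d j, freq ξ ≤ 2 * shellFreq j := by
  intro ξ hξ
  cases j with
  | none => simp [shellFreq, show freq ξ = 0 from hξ]
  | some j =>
    have : freq ξ < 2 ^ (j + 1) := hξ.2
    rw [zpow_add_one₀ two_ne_zero] at this
    simp only [shellFreq]
    linarith

/-- Growth of the `L²` norm of a solution, by summation over the dyadic shells. -/
theorem exists_norm_le_growth (d : ℕ) {μ : ℝ} (hμ : 0 < μ) :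
    ∃ C : ℝ, 0 < C ∧ ∀ V W : ℝ → L2 d, FourierSolution μ V W → ∀ t : ℝ, 0 ≤ t →
      ‖V t‖ ≤ C * growth μ t * (‖V 0‖ + ‖W 0‖) := by
  obtain ⟨C, hC, hgrowth⟩ := ShellMoments.exists_growth hμ
  refine ⟨Real.sqrt C, Real.sqrt_pos.2 hC, fun V W h t ht ↦ ?_⟩
  have hg := growth_nonneg μ ht
  have hk : 0 ≤ C * growth μ t ^ 2 := by positivity
  have hshell : ∀ j, ‖mulOp (fun ξ ↦ (cutoff (shell d j) ξ : ℂ)) (V t)‖ₑ ^ 2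
      ≤ ENNReal.ofReal (C * growth μ t ^ 2)
        * (‖mulOp (fun ξ ↦ (cutoff (shell d j) ξ : ℂ)) (V 0)‖ₑ ^ 2
          + ‖mulOp (fun ξ ↦ (cutoff (shell d j) ξ : ℂ)) (W 0)‖ₑ ^ 2) := by
    intro j
    have h1 := hgrowth _ _ _ _ _ (h.shellMoments (measurableSet_shell j) (shellFreq_nonneg j)
      (shellFreq_le j) (le_shellFreq j)) t ht
    simp only [add_sub_cancel_right] at h1
    simp only [← ofReal_norm, ← ENNReal.ofReal_pow (norm_nonneg _)]
    rw [← ENNReal.ofReal_add (sq_nonneg _) (sq_nonneg _), ← ENNReal.ofReal_mul hk]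
    exact ENNReal.ofReal_le_ofReal h1
  have hsum : ‖V t‖ₑ ^ 2 ≤ ENNReal.ofReal (C * growth μ t ^ 2) * (‖V 0‖ₑ ^ 2 + ‖W 0‖ₑ ^ 2) := by
    have hdec := enorm_sq_eq_tsum (measurableSet_shell (d := d)) (pairwise_disjoint_shell d)
      (iUnion_shell d)
    rw [hdec (V t), hdec (V 0), hdec (W 0), ← ENNReal.tsum_add, ← ENNReal.tsum_mul_left]
    exact ENNReal.tsum_le_tsum hshell
  have hreal : ‖V t‖ ^ 2 ≤ C * growth μ t ^ 2 * (‖V 0‖ ^ 2 + ‖W 0‖ ^ 2) := by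
    simp only [← ofReal_norm, ← ENNReal.ofReal_pow (norm_nonneg _)] at hsum
    rw [← ENNReal.ofReal_add (sq_nonneg _) (sq_nonneg _), ← ENNReal.ofReal_mul hk] at hsum
    exact (ENNReal.ofReal_le_ofReal_iff (by positivity)).1 hsum
  refine le_of_sq_le_sq ?_ (by positivity)
  refine hreal.trans ?_
  rw [mul_pow, mul_pow, Real.sq_sqrt hC.le]
  refine mul_le_mul_of_nonneg_left ?_ hk
  nlinarith [mul_nonneg (norm_nonneg (V 0)) (norm_nonneg (W 0))]

/-! ### Convergence of the profile -/

theorem norm_cexp_mul_I_sub_one_sub_le (x : ℝ) :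
    ‖Complex.exp (x * Complex.I) - 1 - x * Complex.I‖ ≤ 2 * x ^ 2 := by
  have hx : ‖(x * Complex.I : ℂ)‖ = |x| := by simp
  rcases le_total |x| 1 with h | h
  · have := Complex.norm_exp_sub_one_sub_id_le (x := x * Complex.I) (by rw [hx]; exact h)
    rw [hx, sq_abs] at this
    nlinarith [sq_nonneg x]
  · have h1 := Real.norm_exp_I_mul_ofReal_sub_one_le (x := x)
    rw [mul_comm Complex.I, Real.norm_eq_abs] at h1
    refine (norm_sub_le _ _).trans ?_
    rw [hx]
    nlinarith [sq_abs x, abs_nonneg x]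

theorem mulOp_const_mul {d : ℕ} {a : Space d → ℂ} (ha : BddSymbol a) (c : ℂ) (f : L2 d) :
    mulOp (fun ξ ↦ c * a ξ) f = c • mulOp a f := by
  have h0 : BddSymbol (fun _ : Space d ↦ (0 : ℂ)) := ⟨measurable_const, 0, by simp⟩
  have h1 := mulOp_sub_mul h0 ha (-c) f
  have h2 : mulOp (fun _ : Space d ↦ (0 : ℂ)) f = 0 := by
    refine norm_le_zero_iff.1 ?_
    simpa using norm_mulOp_le h0 (C := 0) (by simp) f
  simpa [h2] using h1

/-- Product rule for a family of complex linear operators with a real parameter. -/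
theorem hasDerivWithinAt_apply {E F : Type*} [NormedAddCommGroup E] [NormedSpace ℂ E]
    [NormedAddCommGroup F] [NormedSpace ℂ F] {M : ℝ → E →L[ℂ] F} {M' : E →L[ℂ] F} {f : ℝ → E}
    {f' : E} {s : Set ℝ} {t : ℝ} (hM : HasDerivWithinAt M M' s t)
    (hf : HasDerivWithinAt f f' s t) :
    HasDerivWithinAt (fun t ↦ M t (f t)) (M' (f t) + M t f') s t := by
  have h := ((isBoundedBilinearMap_apply (𝕜 := ℂ) (E := E) (F := F)).hasFDerivAt
    (M t, f t)).restrictScalars ℝ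
  refine (h.comp_hasDerivWithinAt t (hM.prodMk hf)).congr_deriv ?_
  simp [add_comm]

noncomputable section

/-- The symbol `exp (i s |∇|)`. -/
def phase {d : ℕ} (s : ℝ) (ξ : Space d) : ℂ := Complex.exp ((s * freq ξ : ℝ) * Complex.I)

end

theorem norm_phase {d : ℕ} (s : ℝ) (ξ : Space d) : ‖phase s ξ‖ = 1 :=
  Complex.norm_exp_ofReal_mul_I _

theorem measurable_phase {d : ℕ} (s : ℝ) : Measurable (phase s : Space d → ℂ) :=
  Complex.measurable_exp.comp
    ((Complex.measurable_ofReal.comp (measurable_freq.const_mul s)).mul_const _)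

theorem bddSymbol_phase {d : ℕ} (s : ℝ) : BddSymbol (phase s : Space d → ℂ) :=
  ⟨measurable_phase s, 1, fun ξ ↦ (norm_phase s ξ).le⟩

theorem phase_mul_phase {d : ℕ} (s t : ℝ) (ξ : Space d) :
    phase s ξ * phase t ξ = phase (s + t) ξ := by
  rw [phase, phase, phase, ← Complex.exp_add]
  congr 1
  push_cast
  ring

theorem phase_zero {d : ℕ} (ξ : Space d) : phase 0 ξ = 1 := by
  simp [phase]

theorem bddSymbol_mul_phase_mul_cutoff {d : ℕ} {S : Set (Space d)} (hS : MeasurableSet S)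
    {k : Space d → ℂ} (hk : Measurable k) {K : ℝ} (hK : 0 ≤ K) (h : ∀ ξ ∈ S, ‖k ξ‖ ≤ K) (s : ℝ) :
    BddSymbol (fun ξ ↦ k ξ * phase s ξ * (cutoff S ξ : ℂ)) :=
  bddSymbol_mul_cutoff hS (hk.mul (measurable_phase s)) hK fun ξ hξ ↦ by
    rw [norm_mul, norm_phase, mul_one]
    exact h ξ hξ

/-- On bounded frequencies the half-wave group is differentiable in the operator norm. -/
theorem hasDerivAt_mulOp_phase {d : ℕ} {S : Set (Space d)} (hS : MeasurableSet S) {n : ℝ}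
    (hn : 0 ≤ n) (hSn : ∀ ξ ∈ S, freq ξ ≤ n) {k : Space d → ℂ} (hk : Measurable k) {K : ℝ}
    (hK : 0 ≤ K) (h : ∀ ξ ∈ S, ‖k ξ‖ ≤ K) (σ t : ℝ) :
    HasDerivAt (fun s ↦ mulOp (fun ξ ↦ k ξ * phase (σ * s) ξ * (cutoff S ξ : ℂ)))
      (mulOp (fun ξ ↦ k ξ * (σ * freq ξ * Complex.I) * phase (σ * t) ξ * (cutoff S ξ : ℂ))) t := by
  refine hasDerivAt_mulOp (C := K * (2 * (|σ| * n) ^ 2))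
    (fun s ↦ bddSymbol_mul_phase_mul_cutoff hS hk hK h _)
    (bddSymbol_mul_phase_mul_cutoff hS (K := K * (|σ| * n)) ?_ (by positivity) ?_ _) ?_
  · exact hk.mul (((Complex.measurable_ofReal.comp measurable_freq).const_mul _).mul_const _)
  · intro ξ hξ
    have h1 := hSn ξ hξ
    rw [norm_mul, norm_mul, norm_mul, Complex.norm_I, Complex.norm_real, Complex.norm_real, mul_one,
      Real.norm_of_nonneg (freq_nonneg ξ), Real.norm_eq_abs]
    have := freq_nonneg ξ
    gcongr
    exact h ξ hξ
  · intro s ξ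
    have hE : phase (σ * s) ξ = phase (σ * (s - t)) ξ * phase (σ * t) ξ := by
      rw [phase_mul_phase]
      congr 1
      ring
    have h1 : k ξ * phase (σ * s) ξ * (cutoff S ξ : ℂ) - k ξ * phase (σ * t) ξ * (cutoff S ξ : ℂ)
        - (s - t : ℝ) * (k ξ * (σ * freq ξ * Complex.I) * phase (σ * t) ξ * (cutoff S ξ : ℂ))
        = (k ξ * (phase (σ * (s - t)) ξ - 1 - ((σ * (s - t) * freq ξ : ℝ) : ℂ) * Complex.I)
          * phase (σ * t) ξ) * (cutoff S ξ : ℂ) := by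
      rw [hE]
      push_cast
      ring
    rw [h1, mul_assoc K]
    by_cases hξ : ξ ∈ S
    · rw [cutoff_of_mem hξ, Complex.ofReal_one, mul_one, norm_mul, norm_phase, mul_one, norm_mul]
      refine mul_le_mul (h ξ hξ) ((norm_cexp_mul_I_sub_one_sub_le _).trans ?_) (norm_nonneg _) hK
      have h2 : (freq ξ) ^ 2 ≤ n ^ 2 := pow_le_pow_left₀ (freq_nonneg ξ) (hSn ξ hξ) 2
      have h3 : 0 ≤ (σ * (s - t)) ^ 2 := sq_nonneg _
      rw [mul_pow (|σ|), sq_abs]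
      nlinarith [mul_le_mul_of_nonneg_left h2 h3]
    · rw [cutoff_of_notMem hξ, Complex.ofReal_zero, mul_zero, norm_zero]
      positivity

/-- The frequencies up to `n`. -/
def lowFreq (d : ℕ) (n : ℝ) : Set (Space d) := {ξ | freq ξ ≤ n}

theorem measurableSet_lowFreq (d : ℕ) (n : ℝ) : MeasurableSet (lowFreq d n) :=
  measurable_freq measurableSet_Iic

/-- By Fatou's lemma the norm is bounded by the norms of the low frequency parts. -/
theorem norm_le_of_norm_mulOp_lowFreq_le {d : ℕ} {f : L2 d} {C : ℝ}
    (h : ∀ n : ℕ, ‖mulOp (fun ξ ↦ (cutoff (lowFreq d n) ξ : ℂ)) f‖ ≤ C) : ‖f‖ ≤ C := by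
  have hC : 0 ≤ C := (norm_nonneg _).trans (h 0)
  have hlim : ∀ᵐ ξ ∂(volume : Measure (Space d)), Tendsto
      (fun n : ℕ ↦ mulOp (fun ξ ↦ (cutoff (lowFreq d n) ξ : ℂ)) f ξ) atTop (nhds (f ξ)) := by
    filter_upwards [ae_all_iff.2 fun n : ℕ ↦
      mulOp_coeFn (bddSymbol_cutoff (measurableSet_lowFreq d n)) f] with ξ hξ
    obtain ⟨N, hN⟩ := exists_nat_ge (freq ξ)
    refine tendsto_const_nhds.congr' ?_
    filter_upwards [eventually_ge_atTop N] with n hn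
    have : ξ ∈ lowFreq d n := hN.trans (by exact_mod_cast hn)
    rw [hξ, cutoff_of_mem this]
    simp
  have h1 := Lp.eLpNorm_lim_le_liminf_eLpNorm (p := 2) (fun n ↦ Lp.aestronglyMeasurable
    (mulOp (fun ξ ↦ (cutoff (lowFreq d n) ξ : ℂ)) f)) (f : Space d → ℂ) hlim
  have h2 : liminf (fun n : ℕ ↦ eLpNorm (mulOp (fun ξ ↦ (cutoff (lowFreq d n) ξ : ℂ)) f) 2 volume)
      atTop ≤ ENNReal.ofReal C := by
    refine liminf_le_of_frequently_le' (Frequently.of_forall fun n ↦ ?_)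
    rw [← Lp.enorm_def, ← ofReal_norm]
    exact ENNReal.ofReal_le_ofReal (h n)
  have h3 := h1.trans h2
  rw [← Lp.enorm_def, ← ofReal_norm] at h3
  exact (ENNReal.ofReal_le_ofReal_iff hC).1 h3

/-- Low frequency part of the profile `e^{-iσt|∇|} (∂ₜv + iσ|∇|v)`: its derivative is the forcing
term transported back to time zero. -/
theorem FourierSolution.hasDerivWithinAt_profile {d : ℕ} {μ : ℝ} {V W : ℝ → L2 d}
    (h : FourierSolution μ V W) {σ : ℝ} (hσ : σ ^ 2 = 1) (n : ℕ) {t : ℝ} (ht : t ∈ Ici (0 : ℝ)) :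
    HasDerivWithinAt
      (fun s ↦ mulOp (fun ξ ↦ 1 * phase (-σ * s) ξ * (cutoff (lowFreq d n) ξ : ℂ)) (W s)
        + mulOp (fun ξ ↦ (σ * freq ξ * Complex.I) * phase (-σ * s) ξ
          * (cutoff (lowFreq d n) ξ : ℂ)) (V s))
      (-(((μ / (1 + t) ^ 2 : ℝ) : ℂ)
        • mulOp (fun ξ ↦ 1 * phase (-σ * t) ξ * (cutoff (lowFreq d n) ξ : ℂ)) (V t)))
      (Ici 0) t := by
  have hS := measurableSet_lowFreq d n
  have hn : (0 : ℝ) ≤ n := Nat.cast_nonneg n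
  have hfm : Measurable (fun ξ : Space d ↦ (σ * freq ξ * Complex.I : ℂ)) :=
    ((Complex.measurable_ofReal.comp measurable_freq).const_mul _).mul_const _
  have hfb : ∀ ξ ∈ lowFreq d n, ‖(σ * freq ξ * Complex.I : ℂ)‖ ≤ |σ| * n := by
    intro ξ hξ
    rw [norm_mul, norm_mul, Complex.norm_I, Complex.norm_real, Complex.norm_real, mul_one,
      Real.norm_of_nonneg (freq_nonneg ξ), Real.norm_eq_abs]
    exact mul_le_mul_of_nonneg_left hξ (abs_nonneg σ)
  have h1b : ∀ ξ ∈ lowFreq d n, ‖(1 : ℂ)‖ ≤ 1 := by simp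
  have hM1 := hasDerivAt_mulOp_phase hS hn (fun ξ hξ ↦ hξ) (k := fun _ ↦ 1) measurable_const
    zero_le_one h1b (-σ) t
  have hM2 := hasDerivAt_mulOp_phase hS hn (fun ξ hξ ↦ hξ) hfm (by positivity) hfb (-σ) t
  have hb1 : ∀ s, BddSymbol (fun ξ ↦ 1 * phase (-σ * s) ξ * (cutoff (lowFreq d n) ξ : ℂ)) :=
    fun s ↦ bddSymbol_mul_phase_mul_cutoff hS measurable_const zero_le_one h1b _
  have hb2 : BddSymbol (fun ξ ↦ (σ * freq ξ * Complex.I) * phase (-σ * t) ξ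
      * (cutoff (lowFreq d n) ξ : ℂ)) :=
    bddSymbol_mul_phase_mul_cutoff hS hfm (by positivity) hfb _
  have hχ : BddSymbol (fun ξ ↦ (cutoff (lowFreq d n) ξ : ℂ)) := bddSymbol_cutoff hS
  have hA : BddSymbol (fun ξ ↦ (freq ξ : ℂ) ^ 2 * (cutoff (lowFreq d n) ξ : ℂ)) :=
    bddSymbol_mul_cutoff hS ((Complex.measurable_ofReal.comp measurable_freq).pow_const 2)
      (C := (n : ℝ) ^ 2) (by positivity) fun ξ hξ ↦ by
        rw [norm_pow, Complex.norm_real, Real.norm_of_nonneg (freq_nonneg ξ)]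
        exact pow_le_pow_left₀ (freq_nonneg ξ) hξ 2
  have hcc : ∀ ξ, (cutoff (lowFreq d n) ξ : ℂ) * (cutoff (lowFreq d n) ξ : ℂ)
      = (cutoff (lowFreq d n) ξ : ℂ) := fun ξ ↦ by
    rw [← Complex.ofReal_mul, cutoff_mul_cutoff]
  have hχ1 : ∀ s f, mulOp (fun ξ ↦ 1 * phase (-σ * s) ξ * (cutoff (lowFreq d n) ξ : ℂ))
      (mulOp (fun ξ ↦ (cutoff (lowFreq d n) ξ : ℂ)) f)
      = mulOp (fun ξ ↦ 1 * phase (-σ * s) ξ * (cutoff (lowFreq d n) ξ : ℂ)) f := fun s f ↦ by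
    rw [mulOp_mulOp (hb1 s) hχ]
    congr 2
    ext ξ
    rw [mul_assoc, hcc]
  have d1 := hasDerivWithinAt_apply (hM1.hasDerivWithinAt (s := Ici 0)) (h.deriv_W _ hχ hA t ht)
  have d2 := hasDerivWithinAt_apply (hM2.hasDerivWithinAt (s := Ici 0)) (h.deriv_V t ht)
  have d3 := d1.fun_add d2
  simp only [hχ1] at d3
  refine d3.congr_deriv ?_
  have e1 : ∀ f, mulOp (fun ξ ↦ 1 * ((-σ : ℝ) * freq ξ * Complex.I) * phase (-σ * t) ξ
      * (cutoff (lowFreq d n) ξ : ℂ)) (mulOp (fun ξ ↦ (cutoff (lowFreq d n) ξ : ℂ)) f)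
      = -mulOp (fun ξ ↦ (σ * freq ξ * Complex.I) * phase (-σ * t) ξ
      * (cutoff (lowFreq d n) ξ : ℂ)) f := fun f ↦ by
    have : (fun ξ ↦ 1 * ((-σ : ℝ) * freq ξ * Complex.I) * phase (-σ * t) ξ
      * (cutoff (lowFreq d n) ξ : ℂ)) = fun ξ ↦ (-1) * ((σ * freq ξ * Complex.I) * phase (-σ * t) ξ
      * (cutoff (lowFreq d n) ξ : ℂ)) := by
      ext ξ
      push_cast
      ring
    rw [this, mulOp_const_mul hb2, mulOp_mulOp hb2 hχ, neg_one_smul]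
    congr 3
    ext ξ
    rw [mul_assoc, hcc]
  have e2 : ∀ f, mulOp (fun ξ ↦ 1 * phase (-σ * t) ξ * (cutoff (lowFreq d n) ξ : ℂ))
      (mulOp (fun ξ ↦ (freq ξ : ℂ) ^ 2 * (cutoff (lowFreq d n) ξ : ℂ)) f)
      = mulOp (fun ξ ↦ (σ * freq ξ * Complex.I) * ((-σ : ℝ) * freq ξ * Complex.I) * phase (-σ * t) ξ
      * (cutoff (lowFreq d n) ξ : ℂ)) f := fun f ↦ by
    rw [mulOp_mulOp (hb1 t) hA]
    congr 2
    ext ξ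
    have hσ' : (σ : ℂ) ^ 2 = 1 := by exact_mod_cast hσ
    calc 1 * phase (-σ * t) ξ * (cutoff (lowFreq d n) ξ : ℂ)
          * ((freq ξ : ℂ) ^ 2 * (cutoff (lowFreq d n) ξ : ℂ))
        = phase (-σ * t) ξ * (freq ξ : ℂ) ^ 2
          * ((cutoff (lowFreq d n) ξ : ℂ) * (cutoff (lowFreq d n) ξ : ℂ)) := by ring
      _ = -((σ : ℂ) ^ 2) * (Complex.I ^ 2) * phase (-σ * t) ξ * (freq ξ : ℂ) ^ 2
          * (cutoff (lowFreq d n) ξ : ℂ) := by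
          rw [hcc, hσ', Complex.I_sq]
          ring
      _ = _ := by
          push_cast
          ring
  simp only [map_sub, map_neg, map_smul, hχ1, e1, e2]
  abel

/-- The profile of a solution varies by at most the integral of the size of the forcing term. -/
theorem FourierSolution.norm_profile_sub_le {d : ℕ} {μ : ℝ} {V W U : ℝ → L2 d}
    (h : FourierSolution μ V W)
    (hU : ∀ t ∈ Ici (0 : ℝ), U t =ᵐ[volume] fun ξ ↦ (freq ξ : ℂ) * V t ξ) {R R' : ℝ → ℝ}
    (hR : ∀ t ∈ Ici (0 : ℝ), HasDerivWithinAt R (R' t) (Ici 0) t) (hμ : 0 ≤ μ)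
    (hbound : ∀ t ∈ Ici (0 : ℝ), μ / (1 + t) ^ 2 * ‖V t‖ ≤ -R' t) {σ : ℝ} (hσ : σ ^ 2 = 1)
    {s t : ℝ} (hs : 0 ≤ s) (hst : s ≤ t) :
    ‖mulOp (phase (-σ * t)) (W t + (σ * Complex.I : ℂ) • U t)
      - mulOp (phase (-σ * s)) (W s + (σ * Complex.I : ℂ) • U s)‖ ≤ R s - R t := by
  refine norm_le_of_norm_mulOp_lowFreq_le fun n ↦ ?_
  have hS := measurableSet_lowFreq d n
  set F : ℝ → L2 d := fun s ↦
    mulOp (fun ξ ↦ 1 * phase (-σ * s) ξ * (cutoff (lowFreq d n) ξ : ℂ)) (W s)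
        + mulOp (fun ξ ↦ (σ * freq ξ * Complex.I) * phase (-σ * s) ξ
          * (cutoff (lowFreq d n) ξ : ℂ)) (V s) with hF
  have hb1 : ∀ s, BddSymbol (fun ξ ↦ 1 * phase (-σ * s) ξ * (cutoff (lowFreq d n) ξ : ℂ)) :=
    fun s ↦ bddSymbol_mul_phase_mul_cutoff hS measurable_const zero_le_one (by simp) _
  have hfm : Measurable (fun ξ : Space d ↦ (σ * freq ξ * Complex.I : ℂ)) :=
    ((Complex.measurable_ofReal.comp measurable_freq).const_mul _).mul_const _
  have hfb : ∀ ξ ∈ lowFreq d n, ‖(σ * freq ξ * Complex.I : ℂ)‖ ≤ |σ| * n := by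
    intro ξ hξ
    rw [norm_mul, norm_mul, Complex.norm_I, Complex.norm_real, Complex.norm_real, mul_one,
      Real.norm_of_nonneg (freq_nonneg ξ), Real.norm_eq_abs]
    exact mul_le_mul_of_nonneg_left hξ (abs_nonneg σ)
  have hb2 : ∀ s, BddSymbol (fun ξ ↦ (σ * freq ξ * Complex.I) * phase (-σ * s) ξ
      * (cutoff (lowFreq d n) ξ : ℂ)) := fun s ↦
    bddSymbol_mul_phase_mul_cutoff hS hfm (by positivity) hfb _
  have hFeq : ∀ s ∈ Ici (0 : ℝ), mulOp (fun ξ ↦ (cutoff (lowFreq d n) ξ : ℂ))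
      (mulOp (phase (-σ * s)) (W s + (σ * Complex.I : ℂ) • U s)) = F s := by
    intro s hs
    rw [mulOp_mulOp (bddSymbol_cutoff hS) (bddSymbol_phase _)]
    apply Lp.ext
    filter_upwards [mulOp_coeFn ((bddSymbol_cutoff hS).mul (bddSymbol_phase (-σ * s)))
      (W s + (σ * Complex.I : ℂ) • U s), mulOp_coeFn (hb1 s) (W s), mulOp_coeFn (hb2 s) (V s),
      Lp.coeFn_add (W s) ((σ * Complex.I : ℂ) • U s), Lp.coeFn_smul (σ * Complex.I : ℂ) (U s),
      hU s hs, Lp.coeFn_add (mulOp (fun ξ ↦ 1 * phase (-σ * s) ξ * (cutoff (lowFreq d n) ξ : ℂ))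
        (W s)) (mulOp (fun ξ ↦ (σ * freq ξ * Complex.I) * phase (-σ * s) ξ
          * (cutoff (lowFreq d n) ξ : ℂ)) (V s))] with ξ h1 h2 h3 h4 h5 h6 h7
    rw [h1, h4, hF, h7, Pi.add_apply, Pi.add_apply, h2, h3, h5, Pi.smul_apply, h6, smul_eq_mul]
    ring
  rw [map_sub, hFeq t (hs.trans hst), hFeq s hs]
  have hFd : ∀ x ∈ Ici (0 : ℝ), HasDerivWithinAt F (-(((μ / (1 + x) ^ 2 : ℝ) : ℂ)
        • mulOp (fun ξ ↦ 1 * phase (-σ * x) ξ * (cutoff (lowFreq d n) ξ : ℂ)) (V x))) (Ici 0) x :=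
    fun x hx ↦ h.hasDerivWithinAt_profile hσ n hx
  have hsub : Icc s t ⊆ Ici 0 := fun x hx ↦ hs.trans hx.1
  -- Mean value inequality with the majorant `R s - R x`.
  refine image_norm_le_of_norm_deriv_right_le_deriv_boundary' (a := s) (b := t)
    (f := fun x ↦ F x - F s) (B := fun x ↦ R s - R x) (B' := fun x ↦ -R' x)
    (f' := fun x ↦ -(((μ / (1 + x) ^ 2 : ℝ) : ℂ)
        • mulOp (fun ξ ↦ 1 * phase (-σ * x) ξ * (cutoff (lowFreq d n) ξ : ℂ)) (V x)))
    ?_ ?_ (by simp) ?_ ?_ ?_ (right_mem_Icc.2 hst)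
  · exact fun x hx ↦ ((hFd x (hsub hx)).continuousWithinAt.mono hsub).sub continuousWithinAt_const
  · exact fun x hx ↦ ((hFd x (hs.trans hx.1)).mono (Ici_subset_Ici.2 (hs.trans hx.1))).sub_const _
  · exact fun x hx ↦ continuousWithinAt_const.sub ((hR x (hsub hx)).continuousWithinAt.mono hsub)
  · exact fun x hx ↦ ((hR x (hs.trans hx.1)).mono (Ici_subset_Ici.2 (hs.trans hx.1))).const_sub _
  · intro x hx
    refine le_trans ?_ (hbound x (hs.trans hx.1))
    rw [norm_neg, norm_smul, Complex.norm_real, Real.norm_of_nonneg (by positivity)]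
    refine mul_le_mul_of_nonneg_left ?_ (by positivity)
    refine (norm_mulOp_le (hb1 x) (C := 1) (norm_mul_cutoff_le zero_le_one fun ξ _ ↦ ?_) _).trans_eq
      (one_mul _)
    rw [one_mul, norm_phase]

/-- A function on `[0, ∞)` whose increments are bounded by those of a nonnegative function
converges, with the corresponding rate. -/
theorem exists_limit_of_norm_sub_le {E : Type*} [NormedAddCommGroup E] [CompleteSpace E]
    {f : ℝ → E} {R : ℝ → ℝ} (hR : ∀ t, 0 ≤ t → 0 ≤ R t)
    (h : ∀ s t, 0 ≤ s → s ≤ t → ‖f t - f s‖ ≤ R s - R t) :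
    ∃ g : E, ∀ t, 0 ≤ t → ‖f t - g‖ ≤ R t := by
  have hanti : Antitone (fun n : ℕ ↦ R n) := fun m n hmn ↦ by
    have := (norm_nonneg _).trans (h m n m.cast_nonneg (by exact_mod_cast hmn))
    linarith
  have hlim := tendsto_atTop_ciInf hanti ⟨0, by rintro _ ⟨n, rfl⟩; exact hR n n.cast_nonneg⟩
  have hcauchy : CauchySeq (fun n : ℕ ↦ f n) := by
    rw [Metric.cauchySeq_iff']
    intro ε hε
    obtain ⟨N, hN⟩ := Metric.cauchySeq_iff'.1 hlim.cauchySeq ε hε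
    refine ⟨N, fun n hn ↦ ?_⟩
    rw [dist_eq_norm]
    have h1 := h N n N.cast_nonneg (by exact_mod_cast hn)
    have h2 := hN n hn
    rw [Real.dist_eq, abs_lt] at h2
    linarith [h2.1]
  obtain ⟨g, hg⟩ := cauchySeq_tendsto_of_complete hcauchy
  refine ⟨g, fun t ht ↦ ?_⟩
  refine le_of_tendsto ((tendsto_const_nhds.sub hg).norm) ?_
  obtain ⟨N, hN⟩ := exists_nat_ge t
  filter_upwards [eventually_ge_atTop N] with n hn
  have h1 := h t n ht (hN.trans (by exact_mod_cast hn))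
  have h2 := hR n n.cast_nonneg
  rw [norm_sub_rev]
  linarith

/-- Each of the half waves `∂ₜv ± i|∇|v` approaches a free half wave, the rate being the integral of
the forcing term. -/
theorem FourierSolution.exists_halfWave_limit {d : ℕ} {μ : ℝ} {V W U : ℝ → L2 d}
    (h : FourierSolution μ V W)
    (hU : ∀ t ∈ Ici (0 : ℝ), U t =ᵐ[volume] fun ξ ↦ (freq ξ : ℂ) * V t ξ) {R R' : ℝ → ℝ}
    (hR0 : ∀ t, 0 ≤ t → 0 ≤ R t)
    (hR : ∀ t ∈ Ici (0 : ℝ), HasDerivWithinAt R (R' t) (Ici 0) t) (hμ : 0 ≤ μ)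
    (hbound : ∀ t ∈ Ici (0 : ℝ), μ / (1 + t) ^ 2 * ‖V t‖ ≤ -R' t) {σ : ℝ} (hσ : σ ^ 2 = 1) :
    ∃ g : L2 d, ∀ t, 0 ≤ t →
      ‖W t + (σ * Complex.I : ℂ) • U t - mulOp (phase (σ * t)) g‖ ≤ R t := by
  obtain ⟨g, hg⟩ := exists_limit_of_norm_sub_le
    (f := fun t ↦ mulOp (phase (-σ * t)) (W t + (σ * Complex.I : ℂ) • U t)) hR0
    fun s t hs hst ↦ h.norm_profile_sub_le hU hR hμ hbound hσ hs hst
  refine ⟨g, fun t ht ↦ ?_⟩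
  have h1 : ∀ f : L2 d, mulOp (phase (σ * t)) (mulOp (phase (-σ * t)) f) = f := fun f ↦ by
    rw [mulOp_mulOp (bddSymbol_phase _) (bddSymbol_phase _)]
    simp only [phase_mul_phase]
    apply Lp.ext
    filter_upwards [mulOp_coeFn (bddSymbol_phase (σ * t + -σ * t)) f] with ξ hξ
    rw [hξ, show σ * t + -σ * t = 0 by ring, phase_zero, one_mul]
  conv_lhs => rw [← h1 (W t + (σ * Complex.I : ℂ) • U t)]
  rw [← map_sub]
  refine (norm_mulOp_le (bddSymbol_phase _) (C := 1) (fun ξ ↦ (norm_phase _ ξ).le) _).trans ?_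
  rw [one_mul]
  exact hg t ht

noncomputable section

/-- The symbol `cos (t|∇|)`. -/
def cosSymbol {d : ℕ} (t : ℝ) (ξ : Space d) : ℂ := (Real.cos (t * freq ξ) : ℝ)

/-- The symbol `sin (t|∇|)`. -/
def sinSymbol {d : ℕ} (t : ℝ) (ξ : Space d) : ℂ := (Real.sin (t * freq ξ) : ℝ)

end

theorem bddSymbol_cosSymbol {d : ℕ} (t : ℝ) : BddSymbol (cosSymbol t : Space d → ℂ) := by
  refine ⟨Complex.measurable_ofReal.comp (Real.measurable_cos.comp (measurable_freq.const_mul t)),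
    1, fun ξ ↦ ?_⟩
  rw [cosSymbol, Complex.norm_real]
  exact Real.abs_cos_le_one _

theorem bddSymbol_sinSymbol {d : ℕ} (t : ℝ) : BddSymbol (sinSymbol t : Space d → ℂ) := by
  refine ⟨Complex.measurable_ofReal.comp (Real.measurable_sin.comp (measurable_freq.const_mul t)),
    1, fun ξ ↦ ?_⟩
  rw [sinSymbol, Complex.norm_real]
  exact Real.abs_sin_le_one _

theorem mulOp_phase {d : ℕ} (t : ℝ) (f : L2 d) :
    mulOp (phase t) f = mulOp (cosSymbol t) f + Complex.I • mulOp (sinSymbol t) f := by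
  have h := mulOp_sub_mul (bddSymbol_cosSymbol (d := d) t) (bddSymbol_sinSymbol t) (-Complex.I) f
  rw [neg_smul, sub_neg_eq_add] at h
  rw [← h]
  congr 2
  ext ξ
  rw [phase, Complex.exp_mul_I, cosSymbol, sinSymbol]
  push_cast
  ring

theorem mulOp_cosSymbol_neg {d : ℕ} (t : ℝ) (f : L2 d) :
    mulOp (cosSymbol (-t)) f = mulOp (cosSymbol t) f := by
  congr 2
  ext ξ
  simp [cosSymbol]

theorem mulOp_sinSymbol_neg {d : ℕ} (t : ℝ) (f : L2 d) :
    mulOp (sinSymbol (-t)) f = -mulOp (sinSymbol t) f := by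
  rw [← neg_one_smul ℂ (mulOp (sinSymbol t) f), ← mulOp_const_mul (bddSymbol_sinSymbol t)]
  congr 2
  ext ξ
  simp [sinSymbol]

/-- Scattering on the Fourier side: `g` and `k` are the Fourier transforms of `|∇|` applied to the
asymptotic position and of the asymptotic velocity. -/
theorem FourierSolution.exists_scattering {d : ℕ} {μ : ℝ} {V W U : ℝ → L2 d}
    (h : FourierSolution μ V W)
    (hU : ∀ t ∈ Ici (0 : ℝ), U t =ᵐ[volume] fun ξ ↦ (freq ξ : ℂ) * V t ξ) {R R' : ℝ → ℝ}
    (hR0 : ∀ t, 0 ≤ t → 0 ≤ R t)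
    (hR : ∀ t ∈ Ici (0 : ℝ), HasDerivWithinAt R (R' t) (Ici 0) t) (hμ : 0 ≤ μ)
    (hbound : ∀ t ∈ Ici (0 : ℝ), μ / (1 + t) ^ 2 * ‖V t‖ ≤ -R' t) :
    ∃ g k : L2 d, ∀ t, 0 ≤ t →
      ‖U t - (mulOp (cosSymbol t) g + mulOp (sinSymbol t) k)‖ ≤ R t ∧
      ‖W t - (mulOp (cosSymbol t) k - mulOp (sinSymbol t) g)‖ ≤ R t := by
  obtain ⟨p, hp⟩ := h.exists_halfWave_limit hU hR0 hR hμ hbound (σ := 1) (by norm_num)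
  obtain ⟨q, hq⟩ := h.exists_halfWave_limit hU hR0 hR hμ hbound (σ := -1) (by norm_num)
  -- `U` and `W` are recovered from the half waves as `-(i/2)` times their difference and half
  -- their sum.
  refine ⟨(-(Complex.I / 2)) • (p - q), (1 / 2 : ℂ) • (p + q), fun t ht ↦ ?_⟩
  have hp' := hp t ht
  have hq' := hq t ht
  rw [one_mul, mulOp_phase] at hp'
  rw [neg_one_mul, mulOp_phase, mulOp_cosSymbol_neg, mulOp_sinSymbol_neg] at hq'
  set A := W t + (((1 : ℝ) : ℂ) * Complex.I) • U t
    - (mulOp (cosSymbol t) p + Complex.I • mulOp (sinSymbol t) p) with hA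
  set B := W t + (((-1 : ℝ) : ℂ) * Complex.I) • U t
    - (mulOp (cosSymbol t) q + Complex.I • -mulOp (sinSymbol t) q) with hB
  have hI : Complex.I * Complex.I = -1 := Complex.I_mul_I
  have h1 : U t - (mulOp (cosSymbol t) ((-(Complex.I / 2)) • (p - q))
      + mulOp (sinSymbol t) ((1 / 2 : ℂ) • (p + q))) = (-(Complex.I / 2)) • (A - B) := by
    rw [hA, hB]
    simp only [map_smul, map_sub, map_add]
    match_scalars <;> simp <;> ring_nf <;> simp <;> ring
  have h2 : W t - (mulOp (cosSymbol t) ((1 / 2 : ℂ) • (p + q))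
      - mulOp (sinSymbol t) ((-(Complex.I / 2)) • (p - q))) = (1 / 2 : ℂ) • (A + B) := by
    rw [hA, hB]
    simp only [map_smul, map_sub, map_add]
    match_scalars <;> simp <;> ring
  rw [h1, h2, norm_smul, norm_smul]
  have h3 := norm_sub_le A B
  have h4 := norm_add_le A B
  constructor <;> norm_num <;> linarith

/-! ### Homogeneous Sobolev representatives and the energy norm -/

theorem freq_zero {d : ℕ} : freq (0 : Space d) = 0 := by simp [freq]

theorem freq_pos {d : ℕ} {ξ : Space d} (h : ξ ≠ 0) : 0 < freq ξ := by
  have := norm_pos_iff.2 h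
  unfold freq
  positivity

/-- The quotient of a Schwartz function, with its value at the origin subtracted on the unit ball, by
`|2πξ|` is bounded, by the mean value inequality near the origin, and decays rapidly. -/
theorem exists_one_add_norm_pow_mul_le (d n : ℕ) : ∃ C : ℝ, 0 ≤ C ∧
    ∀ (φ : 𝓢(Space d, ℂ)) (ξ : Space d),
      ‖(φ ξ - (Metric.closedBall (0 : Space d) 1).indicator (fun _ ↦ φ 0) ξ) / freq ξ‖
        ≤ C * (Finset.Iic (n, 1)).sup (schwartzSeminormFamily ℂ (Space d) ℂ) φ
          * ((1 + ‖ξ‖) ^ n)⁻¹ := by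
  refine ⟨2 ^ n, by positivity, fun φ ξ ↦ ?_⟩
  set S := (Finset.Iic (n, 1)).sup (schwartzSeminormFamily ℂ (Space d) ℂ) φ with hS
  have hpi : 1 ≤ 2 * Real.pi := by linarith [Real.two_le_pi]
  have hS0 : 0 ≤ S := apply_nonneg _ _
  have hpow : (0 : ℝ) < (1 + ‖ξ‖) ^ n := by positivity
  rw [← div_eq_mul_inv, le_div_iff₀ hpow]
  rcases eq_or_ne ξ 0 with rfl | hξ
  · rw [freq_zero]
    simp only [Complex.ofReal_zero, div_zero, norm_zero, zero_mul]
    positivity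
  have hξ' := norm_pos_iff.2 hξ
  rw [norm_div, Complex.norm_real, Real.norm_of_nonneg (freq_nonneg ξ), div_mul_eq_mul_div,
    div_le_iff₀ (freq_pos hξ)]
  by_cases hb : ξ ∈ Metric.closedBall (0 : Space d) 1
  · rw [indicator_of_mem hb]
    have hξ1 : ‖ξ‖ ≤ 1 := by simpa using hb
    have h1 : ∀ x, ‖fderiv ℝ φ x‖ ≤ S := fun x ↦ by
      have h2 := SchwartzMap.le_seminorm ℂ 0 1 φ x
      rw [pow_zero, one_mul, norm_iteratedFDeriv_one] at h2
      refine h2.trans ?_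
      exact Seminorm.le_finset_sup_apply
        (p := schwartzSeminormFamily ℂ (Space d) ℂ) (s := Finset.Iic (n, 1)) (x := φ)
        (i := (0, 1)) (Finset.mem_Iic.2 ⟨Nat.zero_le _, le_rfl⟩)
    have h3 := Convex.norm_image_sub_le_of_norm_fderiv_le (𝕜 := ℝ) (f := φ) (C := S)
      (fun x _ ↦ φ.differentiableAt) (fun x _ ↦ h1 x) convex_univ (mem_univ 0) (mem_univ ξ)
    rw [sub_zero] at h3
    have h4 : (1 + ‖ξ‖) ^ n ≤ 2 ^ n := pow_le_pow_left₀ (by positivity) (by linarith) n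
    calc ‖φ ξ - φ 0‖ * (1 + ‖ξ‖) ^ n ≤ (S * ‖ξ‖) * 2 ^ n := by gcongr
      _ = 2 ^ n * S * (1 * ‖ξ‖) := by ring
      _ ≤ 2 ^ n * S * (2 * Real.pi * ‖ξ‖) := by gcongr
  · rw [indicator_of_notMem hb, sub_zero]
    have hξ1 : 1 ≤ ‖ξ‖ := by
      simp only [Metric.mem_closedBall, dist_zero_right, not_le] at hb
      exact hb.le
    have h1 := SchwartzMap.one_add_le_sup_seminorm_apply (𝕜 := ℂ) (m := (n, 1)) (k := n) (n := 0)
      le_rfl zero_le_one φ ξ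
    rw [norm_iteratedFDeriv_zero] at h1
    have h2 : 1 ≤ freq ξ := by
      unfold freq
      nlinarith
    calc ‖φ ξ‖ * (1 + ‖ξ‖) ^ n = (1 + ‖ξ‖) ^ n * ‖φ ξ‖ := mul_comm _ _
      _ ≤ 2 ^ n * S * 1 := by rw [mul_one]; exact h1
      _ ≤ 2 ^ n * S * freq ξ := by gcongr

theorem memLp_inv_one_add_norm_pow (d : ℕ) :
    MemLp (fun ξ : Space d ↦ ((1 + ‖ξ‖) ^ (d + 1))⁻¹) 2 volume := by
  have hc : Continuous (fun ξ : Space d ↦ ((1 + ‖ξ‖) ^ (d + 1))⁻¹) := by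
    refine Continuous.inv₀ (by fun_prop) fun ξ ↦ ?_
    positivity
  rw [memLp_two_iff_integrable_sq hc.aestronglyMeasurable]
  have h := integrable_one_add_norm (E := Space d) (μ := volume) (r := ((2 * (d + 1) : ℕ) : ℝ)) (by
    rw [finrank_euclideanSpace_fin]
    push_cast
    linarith)
  refine h.congr (Eventually.of_forall fun ξ ↦ ?_)
  simp only
  rw [Real.rpow_neg (by positivity), Real.rpow_natCast, inv_pow, ← pow_mul, mul_comm 2]

theorem integrable_riesz {d : ℕ} (g : L2 d) (φ : 𝓢(Space d, ℂ)) :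
    Integrable (fun ξ ↦ (φ ξ - (Metric.closedBall (0 : Space d) 1).indicator (fun _ ↦ φ 0) ξ)
      / freq ξ * g ξ) := by
  obtain ⟨C, hC, h⟩ := exists_one_add_norm_pow_mul_le d (d + 1)
  have h1 := ((memLp_inv_one_add_norm_pow d).const_mul
    (C * (Finset.Iic (d + 1, 1)).sup (schwartzSeminormFamily ℂ (Space d) ℂ) φ)).integrable_mul
    (Lp.memLp g).norm
  refine h1.mono' ?_ (Eventually.of_forall fun ξ ↦ ?_)
  · refine AEStronglyMeasurable.mul (Measurable.aestronglyMeasurable ?_) (Lp.aestronglyMeasurable g)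
    exact (φ.continuous.measurable.sub (measurable_const.indicator
      Metric.isClosed_closedBall.measurableSet)).div (Complex.measurable_ofReal.comp measurable_freq)
  · rw [norm_mul]
    exact mul_le_mul_of_nonneg_right (h φ ξ) (norm_nonneg _)

noncomputable section

/-- The tempered distribution `|2πξ|⁻¹ g(ξ)`. In low dimensions this function need not be locally
integrable, so the value of the test function at the origin is subtracted on the unit ball; this
choice affects the distribution only by a multiple of the Dirac mass at the origin, that is, its
inverse Fourier transform only by a constant. -/
def riesz {d : ℕ} (g : L2 d) : 𝓢'(Space d, ℂ) :=
  ContinuousLinearMap.toPointwiseConvergenceCLM _ _ _ _ <|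
  SchwartzMap.mkCLMtoNormedSpace (𝕜 := ℂ) (σ := RingHom.id ℂ)
    (fun φ ↦ ∫ ξ, (φ ξ - (Metric.closedBall (0 : Space d) 1).indicator (fun _ ↦ φ 0) ξ)
      / freq ξ * g ξ)
    (fun φ ψ ↦ by
      rw [← integral_add (integrable_riesz g φ) (integrable_riesz g ψ)]
      refine integral_congr_ae (Eventually.of_forall fun ξ ↦ ?_)
      by_cases h : ξ ∈ Metric.closedBall (0 : Space d) 1
      · simp only [add_apply, indicator_of_mem h]
        ring
      · simp only [add_apply, indicator_of_notMem h]
        ring)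
    (fun a φ ↦ by
      rw [RingHom.id_apply, smul_eq_mul, ← integral_const_mul]
      refine integral_congr_ae (Eventually.of_forall fun ξ ↦ ?_)
      by_cases h : ξ ∈ Metric.closedBall (0 : Space d) 1
      · simp only [smul_apply, indicator_of_mem h, smul_eq_mul]
        ring
      · simp only [smul_apply, indicator_of_notMem h, smul_eq_mul]
        ring)
    (by
      obtain ⟨C, hC, h⟩ := exists_one_add_norm_pow_mul_le d (d + 1)
      refine ⟨Finset.Iic (d + 1, 1), C * ∫ ξ, ((1 + ‖ξ‖) ^ (d + 1))⁻¹ * ‖g ξ‖, ?_, fun φ ↦ ?_⟩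
      · refine mul_nonneg hC (integral_nonneg fun ξ ↦ ?_)
        positivity
      · rw [mul_right_comm, ← integral_const_mul]
        refine norm_integral_le_of_norm_le (((memLp_inv_one_add_norm_pow d).integrable_mul
          (Lp.memLp g).norm).const_mul _) (Eventually.of_forall fun ξ ↦ ?_)
        rw [norm_mul]
        refine (mul_le_mul_of_nonneg_right (h φ ξ) (norm_nonneg _)).trans_eq ?_
        ring)

end

theorem riesz_apply_of_eq_zero {d : ℕ} (g : L2 d) {φ : 𝓢(Space d, ℂ)} (h : φ 0 = 0) :
    riesz g φ = ∫ ξ, φ ξ / freq ξ * g ξ := by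
  refine integral_congr_ae (Eventually.of_forall fun ξ ↦ ?_)
  simp [h]

/-- A symbol vanishing at the origin turns `|2πξ|⁻¹ g` into a genuine `L²` function. -/
theorem smulLeftCLM_riesz {d : ℕ} {a : Space d → ℂ} (ha : a.HasTemperateGrowth) (h0 : a 0 = 0)
    (hb : BddSymbol (fun ξ ↦ a ξ / freq ξ)) (g : L2 d) :
    TemperedDistribution.smulLeftCLM ℂ a (riesz g)
      = (mulOp (fun ξ ↦ a ξ / freq ξ) g : 𝓢'(Space d, ℂ)) := by
  ext φ
  rw [TemperedDistribution.smulLeftCLM_apply_apply, riesz_apply_of_eq_zero, ← pairing_apply,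
    pairing_mulOp hb]
  · refine integral_congr_ae (Eventually.of_forall fun ξ ↦ ?_)
    simp only [SchwartzMap.smulLeftCLM_apply_apply ha, smul_eq_mul]
    ring
  · rw [SchwartzMap.smulLeftCLM_apply_apply ha, h0, zero_smul]

theorem smulLeftCLM_coe {d : ℕ} {a : Space d → ℂ} (ha : a.HasTemperateGrowth)
    (hb : BddSymbol a) (g : L2 d) :
    TemperedDistribution.smulLeftCLM ℂ a (g : 𝓢'(Space d, ℂ))
      = (mulOp a g : 𝓢'(Space d, ℂ)) := by
  ext φ
  rw [TemperedDistribution.smulLeftCLM_apply_apply, ← pairing_apply φ, pairing_mulOp hb,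
    Lp.toTemperedDistribution_apply]
  refine integral_congr_ae (Eventually.of_forall fun ξ ↦ ?_)
  simp only [SchwartzMap.smulLeftCLM_apply_apply ha, smul_eq_mul]
  ring

/-- A symbol of order one acts on `V` as a bounded symbol on `|∇| V`. -/
theorem smulLeftCLM_coe_of_freq_mul {d : ℕ} {a : Space d → ℂ} (ha : a.HasTemperateGrowth)
    (h0 : a 0 = 0) (hb : BddSymbol (fun ξ ↦ a ξ / freq ξ)) {U V : L2 d}
    (hU : U =ᵐ[volume] fun ξ ↦ (freq ξ : ℂ) * V ξ) :
    TemperedDistribution.smulLeftCLM ℂ a (V : 𝓢'(Space d, ℂ))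
      = (mulOp (fun ξ ↦ a ξ / freq ξ) U : 𝓢'(Space d, ℂ)) := by
  ext φ
  rw [TemperedDistribution.smulLeftCLM_apply_apply, ← pairing_apply φ, pairing_mulOp hb,
    Lp.toTemperedDistribution_apply]
  refine integral_congr_ae ?_
  filter_upwards [hU] with ξ h
  simp only [SchwartzMap.smulLeftCLM_apply_apply ha, smul_eq_mul, h]
  rcases eq_or_ne ξ 0 with rfl | hξ
  · simp [h0]
  · have : (freq ξ : ℂ) ≠ 0 := by exact_mod_cast (freq_pos hξ).ne'
    field_simp

theorem coe_add_toTemperedDistribution {d : ℕ} (f g : L2 d) :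
    ((f + g : L2 d) : 𝓢'(Space d, ℂ)) = (f : 𝓢'(Space d, ℂ)) + (g : 𝓢'(Space d, ℂ)) :=
  map_add (Lp.toTemperedDistributionCLM ℂ (volume : Measure (Space d)) 2) f g

theorem coe_sub_toTemperedDistribution {d : ℕ} (f g : L2 d) :
    ((f - g : L2 d) : 𝓢'(Space d, ℂ)) = (f : 𝓢'(Space d, ℂ)) - (g : 𝓢'(Space d, ℂ)) :=
  map_sub (Lp.toTemperedDistributionCLM ℂ (volume : Measure (Space d)) 2) f g

theorem fourier_sub_temperedDistribution {d : ℕ} (S T : 𝓢'(Space d, ℂ)) : 𝓕 (S - T) = 𝓕 S - 𝓕 T :=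
  map_sub (fourierCLM ℂ 𝓢'(Space d, ℂ)) S T

theorem l2Norm_le_of_fourier_eq {d : ℕ} {f : 𝓢'(Space d, ℂ)} {u : L2 d}
    (h : 𝓕 f = (u : 𝓢'(Space d, ℂ))) : l2Norm f ≤ ‖u‖ₑ := by
  have h1 : f = ((𝓕⁻ u : L2 d) : 𝓢'(Space d, ℂ)) := by
    rw [← Lp.fourierInv_toTemperedDistribution_eq, ← h, FourierTransform.fourierInv_fourier_eq]
  have h2 : ‖(𝓕⁻ u : L2 d)‖ₑ = ‖u‖ₑ := by
    rw [← ofReal_norm, ← ofReal_norm, ← Lp.norm_fourier_eq (𝓕⁻ u : L2 d),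
      FourierTransform.fourier_fourierInv_eq]
  exact (iInf₂_le (𝓕⁻ u : L2 d) h1).trans_eq h2

/-- A uniform bound for all components, with the crude constant `d + 1 ≥ √(d + 1)`. -/
theorem energyNorm_le {d : ℕ} {p : 𝓢'(Space d, ℂ) × 𝓢'(Space d, ℂ)} {c : ℝ≥0∞}
    (h1 : ∀ i : Fin d, l2Norm (∂_{(e i : Space d)} p.1) ≤ c) (h2 : l2Norm p.2 ≤ c) :
    energyNorm p ≤ (d + 1) * c := by
  have h3 : homNorm p.1 ^ 2 = ∑ i : Fin d, l2Norm (∂_{(e i : Space d)} p.1) ^ 2 := by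
    rw [homNorm, ← ENNReal.rpow_natCast, ← ENNReal.rpow_mul]
    norm_num
  have h4 : homNorm p.1 ^ 2 + l2Norm p.2 ^ 2 ≤ ((d + 1) * c) ^ 2 := by
    rw [h3]
    calc (∑ i : Fin d, l2Norm (∂_{(e i : Space d)} p.1) ^ 2) + l2Norm p.2 ^ 2
        ≤ (∑ _i : Fin d, c ^ 2) + c ^ 2 := by
          gcongr with i
          exact h1 i
      _ = (d + 1) * c ^ 2 := by
          rw [Finset.sum_const, Finset.card_univ, Fintype.card_fin, nsmul_eq_mul]
          ring
      _ ≤ (d + 1) ^ 2 * c ^ 2 := by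
          gcongr
          exact le_self_pow₀ le_add_self two_ne_zero
      _ = ((d + 1) * c) ^ 2 := by ring
  calc energyNorm p ≤ (((d + 1) * c) ^ 2) ^ (1 / 2 : ℝ) := ENNReal.rpow_le_rpow h4 (by norm_num)
    _ = (d + 1) * c := by
        rw [← ENNReal.rpow_natCast, ← ENNReal.rpow_mul]
        norm_num

theorem homNorm_lt_top {d : ℕ} {f : 𝓢'(Space d, ℂ)}
    (h : ∀ i : Fin d, l2Norm (∂_{(e i : Space d)} f) < ∞) : homNorm f < ∞ := by
  refine ENNReal.rpow_lt_top_of_nonneg (by norm_num) (ENNReal.sum_lt_top.2 fun i _ ↦ ?_).ne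
  exact ENNReal.pow_lt_top (h i)

noncomputable section

/-- The symbol `2πi ξᵢ` of the `i`-th partial derivative. -/
def partialSymbol {d : ℕ} (i : Fin d) (ξ : Space d) : ℂ :=
  2 * Real.pi * Complex.I * ((inner ℝ ξ (e i : Space d) : ℝ) : ℂ)

end

theorem norm_partialSymbol_le {d : ℕ} (i : Fin d) (ξ : Space d) :
    ‖partialSymbol i ξ‖ ≤ freq ξ := by
  have h3 : ‖(2 * Real.pi * Complex.I : ℂ)‖ = 2 * Real.pi := by
    simp [abs_of_pos Real.pi_pos]
  rw [partialSymbol, norm_mul, h3, Complex.norm_real, Real.norm_eq_abs, freq]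
  exact mul_le_mul_of_nonneg_left (abs_inner_e_le i ξ) Real.two_pi_pos.le

theorem partialSymbol_zero {d : ℕ} (i : Fin d) : partialSymbol i (0 : Space d) = 0 := by
  simp [partialSymbol]

theorem norm_partialSymbol_div_freq_le {d : ℕ} (i : Fin d) (ξ : Space d) :
    ‖partialSymbol i ξ / freq ξ‖ ≤ 1 := by
  rw [norm_div, Complex.norm_real, Real.norm_of_nonneg (freq_nonneg ξ)]
  exact div_le_one_of_le₀ (norm_partialSymbol_le i ξ) (freq_nonneg ξ)

theorem bddSymbol_partialSymbol_div_freq {d : ℕ} (i : Fin d) :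
    BddSymbol (fun ξ : Space d ↦ partialSymbol i ξ / freq ξ) :=
  ⟨(hasTemperateGrowth_partialSymbol i).1.continuous.measurable.div
    (Complex.measurable_ofReal.comp measurable_freq), 1, norm_partialSymbol_div_freq_le i⟩

/-- The gradient of the position component of the difference between a function `f` and a free wave,
on the Fourier side. Here `U` is `|∇| f`, and the free wave has the data `g / |∇|` and `k`. -/
theorem fourier_lineDerivOp_sub_W {d : ℕ} (i : Fin d) {U f : L2 d}
    (hU : U =ᵐ[volume] fun ξ ↦ (freq ξ : ℂ) * (𝓕 f : L2 d) ξ) (g k : L2 d) (t : ℝ) :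
    𝓕 (∂_{(e i : Space d)} ((f : 𝓢'(Space d, ℂ))
        - (W0 t (𝓕⁻ (riesz g)) + W1 t (𝓕⁻ (k : 𝓢'(Space d, ℂ))))))
      = (mulOp (fun ξ ↦ partialSymbol i ξ / freq ξ)
        (U - (mulOp (cosSymbol t) g + mulOp (sinSymbol t) k)) : 𝓢'(Space d, ℂ)) := by
  have hp : (partialSymbol i : Space d → ℂ).HasTemperateGrowth := hasTemperateGrowth_partialSymbol i
  have hr := bddSymbol_partialSymbol_div_freq i
  have hc := bddSymbol_cosSymbol (d := d) t
  have hs := bddSymbol_sinSymbol (d := d) t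
  have hcos := hasTemperateGrowth_symbol_cos (d := d) t
  have hsinc := hasTemperateGrowth_symbol_sinc (d := d) t
  have e1 : (fun ξ : Space d ↦ (((fun ξ : Space d ↦
      ((Real.cos (t * (2 * Real.pi * ‖ξ‖)) : ℝ) : ℂ)) * partialSymbol i) ξ) / freq ξ)
      = fun ξ ↦ partialSymbol i ξ / freq ξ * cosSymbol t ξ := by
    ext ξ
    simp only [Pi.mul_apply, cosSymbol, freq]
    ring
  have e2 : ((fun ξ : Space d ↦ ((t * Real.sinc (t * (2 * Real.pi * ‖ξ‖)) : ℝ) : ℂ))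
      * partialSymbol i) = fun ξ ↦ partialSymbol i ξ / freq ξ * sinSymbol t ξ := by
    ext ξ
    -- At the origin both sides vanish; the value of the quotient there is `0 / 0 = 0`.
    rcases eq_or_ne ξ 0 with rfl | hξ
    · simp [partialSymbol_zero]
    · have : (freq ξ : ℂ) ≠ 0 := by exact_mod_cast (freq_pos hξ).ne'
      change ((t * Real.sinc (t * freq ξ) : ℝ) : ℂ) * partialSymbol i ξ = _
      rw [sinSymbol, ← mul_sinc, Complex.ofReal_mul (freq ξ)]
      field_simp
  have t1 : TemperedDistribution.smulLeftCLM ℂ (partialSymbol i)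
      (TemperedDistribution.smulLeftCLM ℂ
        (fun ξ : Space d ↦ ((Real.cos (t * (2 * Real.pi * ‖ξ‖)) : ℝ) : ℂ)) (riesz g))
      = (mulOp (fun ξ ↦ partialSymbol i ξ / freq ξ) (mulOp (cosSymbol t) g) :
        𝓢'(Space d, ℂ)) := by
    rw [TemperedDistribution.smulLeftCLM_smulLeftCLM_apply hcos hp,
      smulLeftCLM_riesz (hcos.mul hp) (by simp [partialSymbol_zero]) (by rw [e1]; exact hr.mul hc),
      e1, mulOp_mulOp hr hc]
  have t2 : TemperedDistribution.smulLeftCLM ℂ (partialSymbol i)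
      (TemperedDistribution.smulLeftCLM ℂ
        (fun ξ : Space d ↦ ((t * Real.sinc (t * (2 * Real.pi * ‖ξ‖)) : ℝ) : ℂ))
        (k : 𝓢'(Space d, ℂ)))
      = (mulOp (fun ξ ↦ partialSymbol i ξ / freq ξ) (mulOp (sinSymbol t) k) :
        𝓢'(Space d, ℂ)) := by
    rw [TemperedDistribution.smulLeftCLM_smulLeftCLM_apply hsinc hp,
      smulLeftCLM_coe (hsinc.mul hp) (by rw [e2]; exact hr.mul hs), e2, mulOp_mulOp hr hs]
  have t3 := smulLeftCLM_coe_of_freq_mul hp (partialSymbol_zero i) hr hU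
  rw [fourier_lineDerivOp, W0, W1, TemperedDistribution.fourierMultiplierCLM_apply,
    TemperedDistribution.fourierMultiplierCLM_apply, FourierTransform.fourier_fourierInv_eq,
    FourierTransform.fourier_fourierInv_eq, fourier_sub_temperedDistribution,
    FourierTransform.fourier_add, FourierTransform.fourier_fourierInv_eq,
    FourierTransform.fourier_fourierInv_eq, map_sub, map_add, Lp.fourier_toTemperedDistribution_eq,
    map_sub, map_add, coe_sub_toTemperedDistribution, coe_add_toTemperedDistribution, ← t1, ← t2,
    ← t3]
  rfl

/-- The velocity component of the difference between `f` and a free wave, on the Fourier side. -/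
theorem fourier_sub_Wdot {d : ℕ} (f g k : L2 d) (t : ℝ) :
    𝓕 ((f : 𝓢'(Space d, ℂ))
        - (W0dot t (𝓕⁻ (riesz g)) + W0 t (𝓕⁻ (k : 𝓢'(Space d, ℂ)))))
      = (((𝓕 f : L2 d) - (mulOp (cosSymbol t) k - mulOp (sinSymbol t) g) : L2 d) :
        𝓢'(Space d, ℂ)) := by
  have hc := bddSymbol_cosSymbol (d := d) t
  have hs := bddSymbol_sinSymbol (d := d) t
  have hcos := hasTemperateGrowth_symbol_cos (d := d) t
  have hsin := hasTemperateGrowth_symbol_mul_sin (d := d) t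
  have e1 : (fun ξ : Space d ↦
      ((-(2 * Real.pi * ‖ξ‖) * Real.sin (t * (2 * Real.pi * ‖ξ‖)) : ℝ) : ℂ) / freq ξ)
      = fun ξ ↦ (-1) * sinSymbol t ξ := by
    ext ξ
    rcases eq_or_ne ξ 0 with rfl | hξ
    · simp [sinSymbol, freq]
    · have : (freq ξ : ℂ) ≠ 0 := by exact_mod_cast (freq_pos hξ).ne'
      change ((-freq ξ * Real.sin (t * freq ξ) : ℝ) : ℂ) / freq ξ = _
      rw [sinSymbol, Complex.ofReal_mul, Complex.ofReal_neg]
      field_simp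
  have e2 : (cosSymbol t : Space d → ℂ) = fun ξ : Space d ↦
      ((Real.cos (t * (2 * Real.pi * ‖ξ‖)) : ℝ) : ℂ) := rfl
  have hs' : BddSymbol (fun ξ : Space d ↦ (-1) * sinSymbol t ξ) :=
    BddSymbol.mul (a := fun _ ↦ -1) ⟨measurable_const, 1, by simp⟩ hs
  rw [e2] at hc ⊢
  rw [W0, W0dot, TemperedDistribution.fourierMultiplierCLM_apply,
    TemperedDistribution.fourierMultiplierCLM_apply, FourierTransform.fourier_fourierInv_eq,
    FourierTransform.fourier_fourierInv_eq, fourier_sub_temperedDistribution,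
    FourierTransform.fourier_add, FourierTransform.fourier_fourierInv_eq,
    FourierTransform.fourier_fourierInv_eq, Lp.fourier_toTemperedDistribution_eq,
    smulLeftCLM_riesz hsin (by simp) (by rw [e1]; exact hs'), e1, smulLeftCLM_coe hcos hc,
    mulOp_const_mul hs, neg_one_smul, ← coe_add_toTemperedDistribution,
    ← coe_sub_toTemperedDistribution, neg_add_eq_sub]

theorem memEnergySpace_riesz {d : ℕ} (g k : L2 d) :
    MemEnergySpace (𝓕⁻ (riesz g), 𝓕⁻ (k : 𝓢'(Space d, ℂ))) := by
  refine ⟨homNorm_lt_top fun i ↦ ?_, ?_⟩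
  · refine (l2Norm_le_of_fourier_eq (u := mulOp (fun ξ ↦ partialSymbol i ξ / freq ξ) g)
      ?_).trans_lt enorm_lt_top
    rw [fourier_lineDerivOp, FourierTransform.fourier_fourierInv_eq]
    exact smulLeftCLM_riesz (hasTemperateGrowth_partialSymbol i) (partialSymbol_zero i)
      (bddSymbol_partialSymbol_div_freq i) g
  · exact (l2Norm_le_of_fourier_eq (u := k)
      (FourierTransform.fourier_fourierInv_eq _)).trans_lt enorm_lt_top

/-- A bound for the forcing term by the derivative of a decreasing function controls the distance
of the solution to a free wave. -/
theorem IsSolution.exists_energyNorm_le {d : ℕ} {μ : ℝ} {v₀ v₁ : L2 d} {v w : ℝ → L2 d}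
    (h : IsSolution μ v₀ v₁ v w) {R R' : ℝ → ℝ} (hR0 : ∀ t, 0 ≤ t → 0 ≤ R t)
    (hR : ∀ t ∈ Ici (0 : ℝ), HasDerivWithinAt R (R' t) (Ici 0) t) (hμ : 0 ≤ μ)
    (hbound : ∀ t ∈ Ici (0 : ℝ), μ / (1 + t) ^ 2 * ‖(𝓕 (v t) : L2 d)‖ ≤ -R' t) :
    ∃ p : 𝓢'(Space d, ℂ) × 𝓢'(Space d, ℂ), MemEnergySpace p ∧ ∀ t : ℝ, 0 ≤ t →
      energyNorm (((v t : 𝓢'(Space d, ℂ)), (w t : 𝓢'(Space d, ℂ))) - freeWave t p)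
        ≤ (d + 1) * ENNReal.ofReal (R t) := by
  choose! U hU using h.fourierSolution.memLp
  obtain ⟨g, k, hgk⟩ := h.fourierSolution.exists_scattering hU hR0 hR hμ hbound
  refine ⟨_, memEnergySpace_riesz g k, fun t ht ↦ energyNorm_le (fun i ↦ ?_) ?_⟩
  · refine (l2Norm_le_of_fourier_eq (fourier_lineDerivOp_sub_W i (hU t ht) g k t)).trans ?_
    rw [← ofReal_norm]
    refine ENNReal.ofReal_le_ofReal (le_trans ?_ (hgk t ht).1)
    simpa using norm_mulOp_le (bddSymbol_partialSymbol_div_freq i) (C := 1)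
      (norm_partialSymbol_div_freq_le i) (U t - (mulOp (cosSymbol t) g + mulOp (sinSymbol t) k))
  · refine (l2Norm_le_of_fourier_eq (fourier_sub_Wdot (w t) g k t)).trans ?_
    rw [← ofReal_norm]
    exact ENNReal.ofReal_le_ofReal (hgk t ht).2

theorem exists_scattering_of_pos (d : ℕ) {μ : ℝ} (hμ : 0 < μ) :
    ∃ C : ℝ, 0 < C ∧ ∀ (v₀ v₁ : L2 d) (v w : ℝ → L2 d), IsSolution μ v₀ v₁ v w →
      ∃ p : 𝓢'(Space d, ℂ) × 𝓢'(Space d, ℂ), MemEnergySpace p ∧ ∀ t : ℝ, 0 ≤ t →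
        energyNorm (((v t : 𝓢'(Space d, ℂ)), (w t : 𝓢'(Space d, ℂ))) - freeWave t p)
          ≤ ENNReal.ofReal (C * (μ * (‖v₀‖ + ‖v₁‖) * rate μ t)) := by
  obtain ⟨C₁, hC₁, h₁⟩ := exists_norm_le_growth d hμ
  obtain ⟨C₂, R, hC₂, hR0, hRle, hR⟩ := exists_primitive_growth hμ
  refine ⟨(d + 1) * (C₁ * C₂), by positivity, fun v₀ v₁ v w h ↦ ?_⟩
  set N := ‖v₀‖ + ‖v₁‖ with hN
  have hN0 : 0 ≤ N := by positivity
  have hV : ∀ t, 0 ≤ t → ‖(𝓕 (v t) : L2 d)‖ ≤ C₁ * growth μ t * N := fun t ht ↦ by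
    have := h₁ _ _ h.fourierSolution t ht
    simpa only [Lp.norm_fourier_eq, h.initial_value, h.initial_velocity] using this
  obtain ⟨p, hp, hpt⟩ := h.exists_energyNorm_le (R := fun t ↦ μ * C₁ * N * R t)
    (R' := fun t ↦ μ * C₁ * N * -(growth μ t / (1 + t) ^ 2))
    (fun t ht ↦ mul_nonneg (by positivity) (hR0 t ht))
    (fun t ht ↦ (hR t ht).const_mul _) hμ.le fun t ht ↦ by
      calc μ / (1 + t) ^ 2 * ‖(𝓕 (v t) : L2 d)‖
          ≤ μ / (1 + t) ^ 2 * (C₁ * growth μ t * N) :=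
            mul_le_mul_of_nonneg_left (hV t ht) (by positivity)
        _ = -(μ * C₁ * N * -(growth μ t / (1 + t) ^ 2)) := by ring
  refine ⟨p, hp, fun t ht ↦ (hpt t ht).trans ?_⟩
  have hd : ((d : ℝ≥0∞) + 1) = ENNReal.ofReal (d + 1) := by
    rw [ENNReal.ofReal_add (by positivity) zero_le_one]
    simp
  rw [hd, ← ENNReal.ofReal_mul (by positivity)]
  refine ENNReal.ofReal_le_ofReal ?_
  calc ((d : ℝ) + 1) * (μ * C₁ * N * R t) ≤ (d + 1) * (μ * C₁ * N * (C₂ * rate μ t)) := by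
        have := hRle t ht
        gcongr
    _ = (d + 1) * (C₁ * C₂) * (μ * N * rate μ t) := by ring

/-- Without potential a solution is a free wave: there is no forcing term, and the profiles are
constant. -/
theorem exists_scattering_of_zero {d : ℕ} {v₀ v₁ : L2 d} {v w : ℝ → L2 d}
    (h : IsSolution 0 v₀ v₁ v w) :
    ∃ p : 𝓢'(Space d, ℂ) × 𝓢'(Space d, ℂ), MemEnergySpace p ∧ ∀ t : ℝ, 0 ≤ t →
      energyNorm (((v t : 𝓢'(Space d, ℂ)), (w t : 𝓢'(Space d, ℂ))) - freeWave t p) = 0 := by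
  obtain ⟨p, hp, hpt⟩ := h.exists_energyNorm_le (R := fun _ ↦ 0) (R' := fun _ ↦ 0)
    (fun _ _ ↦ le_rfl) (fun t _ ↦ hasDerivWithinAt_const _ _ _) le_rfl (fun t _ ↦ by simp)
  exact ⟨p, hp, fun t ht ↦ by simpa using hpt t ht⟩

end KleinGordon

theorem mainTheorem1 (d : ℕ) (hd : 1 ≤ d) (μ : ℝ) (hμ : 0 ≤ μ) :
    ∃ C : ℝ, 0 < C ∧
      ∀ (v₀ v₁ : KleinGordon.L2 d),
        TemperedDistribution.MemSobolev 1 2 (v₀ : 𝓢'(KleinGordon.Space d, ℂ)) →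
        ∀ v w : ℝ → KleinGordon.L2 d, KleinGordon.IsSolution μ v₀ v₁ v w →
          ∃ vplus : 𝓢'(KleinGordon.Space d, ℂ) × 𝓢'(KleinGordon.Space d, ℂ),
            KleinGordon.MemEnergySpace vplus ∧
            ∀ t : ℝ, 0 ≤ t →
              KleinGordon.energyNorm
                  (((v t : 𝓢'(KleinGordon.Space d, ℂ)), (w t : 𝓢'(KleinGordon.Space d, ℂ)))
                    - KleinGordon.freeWave t vplus)
                ≤ ENNReal.ofReal (C * (μ * (‖v₀‖ + ‖v₁‖) * KleinGordon.rate μ t)) := by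
  rcases hμ.eq_or_lt with rfl | hμ
  · refine ⟨1, one_pos, fun v₀ v₁ _ v w h ↦ ?_⟩
    obtain ⟨p, hp, hpt⟩ := KleinGordon.exists_scattering_of_zero h
    exact ⟨p, hp, fun t ht ↦ (hpt t ht).trans_le zero_le⟩
  · obtain ⟨C, hC, h⟩ := KleinGordon.exists_scattering_of_pos d hμ
    exact ⟨C, hC, fun v₀ v₁ _ v w hv ↦ h v₀ v₁ v w hv⟩
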